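/- **Local Deville mean value inequality for Finsler manifolds.** Let $X$ be a real Banach space that admits a $C^1$ Lipschitz bump function, i.e. a $C^1$ and Lipschitz function $b:X\to\mathbb R$ whose support $\overline{\{x: b(x)\neq 0\}}$ is bounded and non-empty. Let $M$ be a connected paracompact (Hausdorff) $C^1$ Banach manifold modeled on $X$, with a $C^1$ Finsler structure in the sense of Palais: a continuous map $\|\cdot\|_M:TM\to[0,\infty)$ whose restriction $\|\cdot\|_x$ to each tangent space $T_xM$ is a norm, such that for every chart $\varphi:U\to X$: (P1) for every $x\in U$, the norm $v\mapsto\|d\varphi^{-1}(\varphi(x))(v)\|_x$ is equivalent to the norm of $X$; (P2) for every $x_0\in U$ and $\varepsilon>0$ there is an open neighbourhood $W\subset U$ of $x_0$ such that for all $x\in W$ and $v\in X$ $$\tfrac1{1+\varepsilon}\|d\varphi^{-1}(\varphi(x_0))(v)\|_{x_0}\le\|d\varphi^{-1}(\varphi(x))(v)\|_x\le(1+\varepsilon)\|d\varphi^{-1}(\varphi(x_0))(v)\|_{x_0}.$$ Let $d(p,q)=\inf_c\int_a^b\|c'(t)\|_{c(t)}\,dt$ be the Finsler metric, the infimum being over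 all piecewise $C^1$ paths $c:[a,b]\to M$ from $p$ to $q$, and let $B(p,r)=\{x\in M: d(p,x)<r\}$. Let $p\in M$, $\delta>0$ and $K\in\mathbb R$, and let $f:B(p,4\delta)\to\mathbb R$ be lower semicontinuous. For $x\in B(p,4\delta)$ let $$D^-f(x)=\{dg(x): g:M\to\mathbb R \text{ is } C^1 \text{ and } f-g \text{ attains a local minimum at } x\}\subset T_xM^*,$$ and for $\xi\in T_xM^*$ let $\|\xi\|_x^*=\sup\{|\xi(v)|: v\in T_xM,\ \|v\|_x=1\}$ (equal to $0$ if $T_xM=\{0\}$). If $\|\xi\|_x^*\le K$ for every $x\in B(p,4\delta)$ and every $\xi\in D^-f(x)$, then $f$ is $K$-Lipschitz on $B(p,\delta)$: $K\ge 0$ and $|f(y)-f(z)|\le K\,d(y,z)$ for all $y,z\in B(p,\delta)$. -/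

import Mathlib

open Set Topology
open scoped Manifold ContDiff

noncomputable section

/-- `X` admits a `C^1` Lipschitz bump function: a `C^1`, Lipschitz function `b : X → ℝ` whose
support `closure {x | b x ≠ 0}` is bounded and non-empty. -/
def HasC1LipschitzBump (X : Type*) [NormedAddCommGroup X] [NormedSpace ℝ X] : Prop :=
  ∃ b : X → ℝ, ContDiff ℝ 1 b ∧ (∃ L : NNReal, LipschitzWith L b) ∧
    Bornology.IsBounded (tsupport b) ∧ (tsupport b).Nonempty

/-- A Finsler structure in the sense of Palais on a `C^1` Banach manifold `M` modeled on `X`.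
The charts `φ` range over the whole (maximal) `C^1` atlas of `M`. For `x` in the domain of `φ`,
the differential of `φ⁻¹` at `φ x` is `mfderiv 𝓘(ℝ, X) 𝓘(ℝ, X) φ.symm (φ x)`, and its values are
tangent vectors at the point `φ.symm (φ x)`, which is `x`. -/
structure PalaisFinsler (X : Type*) [NormedAddCommGroup X] [NormedSpace ℝ X]
    (M : Type*) [TopologicalSpace M] [ChartedSpace X M] [IsManifold 𝓘(ℝ, X) 1 M] where
  /-- the norm on each tangent space -/
  nrm : ∀ x : M, Seminorm ℝ (TangentSpace 𝓘(ℝ, X) x)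
  /-- each of the seminorms is a norm -/
  eq_zero_of_nrm : ∀ (x : M) (v : TangentSpace 𝓘(ℝ, X) x), nrm x v = 0 → v = 0
  /-- the norm is continuous as a function on the tangent bundle -/
  continuous_nrm : Continuous fun w : TangentBundle 𝓘(ℝ, X) M => nrm w.1 w.2
  /-- (P1) read in any chart, the norm of the tangent space is equivalent to the norm of `X` -/
  equiv_nrm : ∀ φ ∈ IsManifold.maximalAtlas 𝓘(ℝ, X) 1 M, ∀ x ∈ φ.source,
    ∃ C : ℝ, 1 ≤ C ∧ ∀ v : X,
      C⁻¹ * ‖v‖ ≤ nrm (φ.symm (φ x)) (mfderiv 𝓘(ℝ, X) 𝓘(ℝ, X) φ.symm (φ x) v) ∧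
      nrm (φ.symm (φ x)) (mfderiv 𝓘(ℝ, X) 𝓘(ℝ, X) φ.symm (φ x) v) ≤ C * ‖v‖
  /-- (P2) in any chart, the norms at points near `x₀` are `(1 + ε)`-equivalent to that at `x₀` -/
  palais : ∀ φ ∈ IsManifold.maximalAtlas 𝓘(ℝ, X) 1 M, ∀ x₀ ∈ φ.source, ∀ ε : ℝ, 0 < ε →
    ∃ W : Set M, IsOpen W ∧ x₀ ∈ W ∧ W ⊆ φ.source ∧ ∀ x ∈ W, ∀ v : X,
      (1 + ε)⁻¹ * nrm (φ.symm (φ x₀)) (mfderiv 𝓘(ℝ, X) 𝓘(ℝ, X) φ.symm (φ x₀) v) ≤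
        nrm (φ.symm (φ x)) (mfderiv 𝓘(ℝ, X) 𝓘(ℝ, X) φ.symm (φ x) v) ∧
      nrm (φ.symm (φ x)) (mfderiv 𝓘(ℝ, X) 𝓘(ℝ, X) φ.symm (φ x) v) ≤
        (1 + ε) * nrm (φ.symm (φ x₀)) (mfderiv 𝓘(ℝ, X) 𝓘(ℝ, X) φ.symm (φ x₀) v)

/-- `c`, restricted to `[a, b]`, is a (continuous) piecewise `C^1` path in `M`: there is a
subdivision `a = t 0 ≤ t 1 ≤ ⋯ ≤ t n = b` such that `c` is `C^1` on each closed piece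
`[t i, t (i + 1)]`. (Pieces reduced to a point impose no condition.) -/
def IsPiecewiseC1Path (X : Type*) [NormedAddCommGroup X] [NormedSpace ℝ X]
    {M : Type*} [TopologicalSpace M] [ChartedSpace X M] (c : ℝ → M) (a b : ℝ) : Prop :=
  a ≤ b ∧ ContinuousOn c (Icc a b) ∧
    ∃ (n : ℕ) (t : Fin (n + 1) → ℝ), Monotone t ∧ t 0 = a ∧ t (Fin.last n) = b ∧
      ∀ i : Fin n, ContMDiffOn 𝓘(ℝ, ℝ) 𝓘(ℝ, X) 1 c (Icc (t i.castSucc) (t i.succ))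

/-- The set `D⁻f(x)` of subdifferentials at `x` of a function `f` defined on `S ⊆ M`: the
differentials at `x` of the `C^1` functions `g : M → ℝ` such that `f - g` attains a local minimum
at `x`. Only the values of `f` on `S` matter. -/
def subdifferential (X : Type*) [NormedAddCommGroup X] [NormedSpace ℝ X]
    {M : Type*} [TopologicalSpace M] [ChartedSpace X M] (f : M → ℝ) (S : Set M) (x : M) :
    Set (TangentSpace 𝓘(ℝ, X) x →L[ℝ] ℝ) :=
  {Δ | ∃ g : M → ℝ, ContMDiff 𝓘(ℝ, X) 𝓘(ℝ, ℝ) 1 g ∧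
    IsLocalMinOn (fun y => f y - g y) S x ∧
    ∀ v : TangentSpace 𝓘(ℝ, X) x, Δ v = mfderiv 𝓘(ℝ, X) 𝓘(ℝ, ℝ) g x v}

namespace PalaisFinsler

variable {X : Type*} [NormedAddCommGroup X] [NormedSpace ℝ X]
  {M : Type*} [TopologicalSpace M] [ChartedSpace X M] [IsManifold 𝓘(ℝ, X) 1 M]

/-- The length of a path on `[a, b]`. For piecewise `C^1` paths, the derivative exists except at
finitely many points, which do not contribute to the integral. -/
def length (F : PalaisFinsler X M) (c : ℝ → M) (a b : ℝ) : ℝ :=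
  ∫ t in a..b, F.nrm (c t) (mfderiv 𝓘(ℝ, ℝ) 𝓘(ℝ, X) c t (1 : ℝ))

/-- The Finsler metric: the infimum of the lengths of the piecewise `C^1` paths from `p` to `q`. -/
def dist (F : PalaisFinsler X M) (p q : M) : ℝ :=
  sInf {l : ℝ | ∃ (c : ℝ → M) (a b : ℝ), IsPiecewiseC1Path X c a b ∧ c a = p ∧ c b = q ∧
    F.length c a b = l}

/-- The open ball for the Finsler metric. -/
def ball (F : PalaisFinsler X M) (p : M) (r : ℝ) : Set M :=
  {x | F.dist p x < r}

/-- The dual norm of a functional on the tangent space at `x`. -/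
def dualNorm (F : PalaisFinsler X M) (x : M) (Δ : TangentSpace 𝓘(ℝ, X) x →L[ℝ] ℝ) : ℝ :=
  sSup {r : ℝ | ∃ v : TangentSpace 𝓘(ℝ, X) x, F.nrm x v = 1 ∧ r = |Δ v|}

/-- `f` is `K`-Lipschitz on `S` for the Finsler metric; as usual, this includes `0 ≤ K`. -/
def IsLipschitzOn (F : PalaisFinsler X M) (K : ℝ) (f : M → ℝ) (S : Set M) : Prop :=
  0 ≤ K ∧ ∀ y ∈ S, ∀ z ∈ S, |f y - f z| ≤ K * F.dist y z

end PalaisFinsler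

end

/-! The classical mean value inequality fails to start because `f` is only lower semicontinuous and
may have few subdifferentials. The bump function repairs this: by the smooth variational principle
(`exists_perturbation_attains_min`), a lower semicontinuous function bounded below on a closed set
attains a minimum there after a perturbation that is small in `C^1`.

In the model space this gives a one-sided inequality along a segment (`sub_le_of_forall_fderiv_le`).
If `f` rose by more than `A` from `z` to `z + w`, one could build a `C^1` function `H` with slope
above `A` in the direction `w` such that `f - H` is too large on the boundary of a thin cylinder
around the segment to be minimal there. The perturbed minimum is then interior and yields a test
function with slope above `A`.

On the manifold, test functions in a chart extend to global ones by a cutoff, and (P2) freezes the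
Finsler norm near a point. Hence `f` is infinitesimally `K(1 + ε)`-Lipschitz at each point
(`eventually_abs_sub_le`), in particular continuous. Comparing right difference quotients of `f`
along a `C^1` path with `K` times the speed, and integrating, bounds the variation of `f` by `K`
times the length (`abs_sub_le_of_path`). Almost shortest paths between points of the small ball stay
in the large one, so taking the infimum over paths concludes. -/

noncomputable section

/-! ### Bump functions and the smooth variational principle -/

/-- A `C^1` Lipschitz bump function can be translated and rescaled so as to be `1` at the origin,
to vanish outside the unit ball, and to be bounded together with its derivative. -/
theorem HasC1LipschitzBump.exists_normalized {X : Type*} [NormedAddCommGroup X] [NormedSpace ℝ X]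
    (hX : HasC1LipschitzBump X) :
    ∃ (b : X → ℝ) (C : ℝ), ContDiff ℝ 1 b ∧ b 0 = 1 ∧ (∀ x, 1 ≤ ‖x‖ → b x = 0) ∧
      0 ≤ C ∧ (∀ x, |b x| ≤ C) ∧ ∀ x, ‖fderiv ℝ b x‖ ≤ C := by
  obtain ⟨b₀, hb, ⟨L, hL⟩, hbd, hne⟩ := hX
  obtain ⟨u, hu⟩ : (Function.support b₀).Nonempty := by
    rw [← closure_nonempty_iff]; exact hne
  have hu : b₀ u ≠ 0 := hu
  obtain ⟨R, hR0, hR⟩ := hbd.subset_ball_lt 0 u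
  set b : X → ℝ := fun x => b₀ (u + R • x) / b₀ u with hbdef
  have h0 : b 0 = 1 := by simp [hbdef, hu]
  have hout : ∀ x, 1 ≤ ‖x‖ → b x = 0 := by
    intro x hx
    have : u + R • x ∉ tsupport b₀ := fun h => by
      have := hR h
      rw [Metric.mem_ball, dist_eq_norm, add_sub_cancel_left, norm_smul, Real.norm_of_nonneg hR0.le]
        at this
      nlinarith
    simp [hbdef, image_eq_zero_of_notMem_tsupport this]
  have hlip : LipschitzWith (L * R.toNNReal / ‖b₀ u‖₊) b := by
    refine LipschitzWith.of_dist_le_mul fun x y => ?_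
    have h1 := hL.dist_le_mul (u + R • x) (u + R • y)
    rw [dist_add_left, dist_smul₀, Real.norm_of_nonneg hR0.le] at h1
    rw [Real.dist_eq] at h1 ⊢
    simp only [hbdef, ← sub_div, abs_div]
    push_cast
    rw [Real.coe_toNNReal _ hR0.le, div_mul_eq_mul_div, Real.norm_eq_abs]
    gcongr
    linarith
  refine ⟨b, 1 + (L * R.toNNReal / ‖b₀ u‖₊ : NNReal), ?_, h0, hout, by positivity, ?_, ?_⟩
  · exact (hb.comp (by fun_prop)).div_const _
  · intro x
    rcases le_total 1 ‖x‖ with h | h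
    · rw [hout x h, abs_zero]; positivity
    · have h1 := hlip.dist_le_mul x 0
      rw [h0, dist_zero_right, Real.dist_eq] at h1
      have h2 := mul_le_of_le_one_right
        (NNReal.coe_nonneg (L * R.toNNReal / ‖b₀ u‖₊ : NNReal)) h
      have h3 := abs_sub_abs_le_abs_sub (b x) 1
      rw [abs_one] at h3
      linarith
  · intro x
    have := norm_fderiv_le_of_lipschitz ℝ hlip (x₀ := x)
    linarith

/-- The smooth variational principle of Deville, Godefroy and Zizler: a lower semicontinuous
function, bounded below on a closed set, attains its minimum there after adding a `C^1` function
which is small together with its derivative. -/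
theorem HasC1LipschitzBump.exists_perturbation_attains_min {X : Type*} [NormedAddCommGroup X]
    [NormedSpace ℝ X] [CompleteSpace X] (hX : HasC1LipschitzBump X) {S : Set X} (hS : IsClosed S)
    (hne : S.Nonempty) {g : X → ℝ} (hg : LowerSemicontinuousOn g S)
    (hbd : ∃ m, ∀ x ∈ S, m ≤ g x) {ε : ℝ} (hε : 0 < ε) :
    ∃ x ∈ S, ∃ τ : X → ℝ, ContDiff ℝ 1 τ ∧ (∀ y, |τ y| ≤ ε) ∧ (∀ y, ‖fderiv ℝ τ y‖ ≤ ε) ∧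
      ∀ y ∈ S, g x + τ x ≤ g y + τ y := by
  classical
  obtain ⟨b, C, hb, hb0, hb1, hC, hbC, hbD⟩ := hX.exists_normalized
  -- The hypotheses sit inside the existential, with default witness `0`, so that the chosen
  -- almost-minimiser is a total function and can be used in the recursion defining `G`.
  have hpick : ∀ (h : X → ℝ) (η : ℝ), ∃ x, 0 < η → (∃ m, ∀ y ∈ S, m ≤ h y) →
      x ∈ S ∧ ∀ y ∈ S, h x ≤ h y + η := by
    intro h η
    by_cases hh : 0 < η ∧ ∃ m, ∀ y ∈ S, m ≤ h y
    · obtain ⟨hη, m, hm⟩ := hh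
      have hbb : BddBelow (h '' S) := ⟨m, by rintro _ ⟨y, hy, rfl⟩; exact hm y hy⟩
      obtain ⟨_, ⟨x, hx, rfl⟩, hlt⟩ := exists_lt_of_csInf_lt (hne.image h)
        (lt_add_of_pos_right (sInf (h '' S)) hη)
      exact ⟨x, fun _ _ => ⟨hx, fun y hy => by
        linarith [csInf_le hbb (mem_image_of_mem h hy)]⟩⟩
    · exact ⟨0, fun h1 h2 => absurd ⟨h1, h2⟩ hh⟩
  choose next hnext using hpick
  set ε' : ℝ := ε / (2 * (C + 1)) with hε'
  have hε'0 : 0 < ε' := by positivity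
  have hε'C : 2 * (ε' * C) ≤ ε := by
    rw [hε']; field_simp; nlinarith
  -- Heights decrease like `4⁻ᵏ` while the bumps are dilated by `2ᵏ`, so their derivatives still
  -- decay like `2⁻ᵏ` and the series converges in `C^1`.
  set δ : ℕ → ℝ := fun k => ε' * (1 / 4) ^ k with hδ
  have hδ0 : ∀ k, 0 < δ k := fun k => by positivity
  let G : ℕ → X → ℝ := fun n => Nat.rec g
    (fun k h x => h x - δ k * b ((2 : ℝ) ^ k • (x - next h (δ k / 2)))) n
  let xs : ℕ → X := fun k => next (G k) (δ k / 2)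
  let u : ℕ → X → ℝ := fun k x => δ k * b ((2 : ℝ) ^ k • (x - xs k))
  have hG : ∀ k x, G (k + 1) x = G k x - u k x := fun k x => rfl
  have hu : ∀ k x, |u k x| ≤ δ k * C := fun k x => by
    simp only [u, abs_mul, abs_of_pos (hδ0 k)]
    exact mul_le_mul_of_nonneg_left (hbC _) (hδ0 k).le
  have hGb : ∀ k, ∃ m, ∀ x ∈ S, m ≤ G k x := by
    intro k
    induction k with
    | zero => exact hbd
    | succ k ih =>
      obtain ⟨m, hm⟩ := ih
      refine ⟨m - δ k * C, fun x hx => ?_⟩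
      rw [hG]
      linarith [hm x hx, (abs_le.1 (hu k x)).2]
  have hxS : ∀ k, xs k ∈ S := fun k => (hnext _ _ (half_pos (hδ0 k)) (hGb k)).1
  have hxmin : ∀ k, ∀ y ∈ S, G k (xs k) ≤ G k y + δ k / 2 :=
    fun k => (hnext _ _ (half_pos (hδ0 k)) (hGb k)).2
  -- Outside the `k`-th bump `G (k + 1)` agrees with `G k`, hence is at least `G k (xs k) - δ k / 2`
  -- on `S`. At `xs k` it has dropped by `δ k`, so a `δ k / 8`-minimiser cannot lie outside. The
  -- form `2 / 2 / 2 ^ k` is the one expected by `cauchySeq_of_le_geometric_two`.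
  have hdist : ∀ k, dist (xs k) (xs (k + 1)) ≤ 2 / 2 / 2 ^ k := by
    intro k
    by_contra! hlt
    have h1 : u k (xs (k + 1)) = 0 := by
      simp only [u]
      rw [hb1, mul_zero]
      rw [norm_smul, norm_pow, Real.norm_ofNat, ← dist_eq_norm, dist_comm]
      rw [div_self two_ne_zero, div_lt_iff₀ (by positivity)] at hlt
      linarith
    have h2 : u k (xs k) = δ k := by simp [u, hb0]
    have h3 := hxmin (k + 1) _ (hxS k)
    rw [hG, hG, h1, h2] at h3
    have h4 := hxmin k _ (hxS (k + 1))
    have h5 : δ (k + 1) = δ k / 4 := by simp only [hδ, pow_succ]; ring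
    linarith [hδ0 k]
  obtain ⟨x, hx⟩ := cauchySeq_tendsto_of_complete (cauchySeq_of_le_geometric_two hdist)
  have hxmem : x ∈ S := hS.mem_of_tendsto hx (Filter.Eventually.of_forall hxS)
  have hs1 : HasSum (fun k => δ k * C) (ε' * (4 / 3) * C) := by
    have := ((hasSum_geometric_of_lt_one (r := (1 / 4 : ℝ)) (by norm_num)
      (by norm_num)).mul_left ε').mul_right C
    rwa [show (1 - 1 / 4 : ℝ)⁻¹ = 4 / 3 by norm_num] at this
  have hs2 : HasSum (fun k => ε' * (1 / 2) ^ k * C) (ε' * 2 * C) :=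
    (hasSum_geometric_two.mul_left ε').mul_right C
  have huc : ∀ k, ContDiff ℝ 1 (u k) := fun k =>
    contDiff_const.mul (hb.comp (contDiff_const.smul (contDiff_id.sub contDiff_const)))
  have huD : ∀ k y, ‖fderiv ℝ (u k) y‖ ≤ ε' * (1 / 2) ^ k * C := by
    intro k y
    have hin : HasFDerivAt (fun z => (2 : ℝ) ^ k • (z - xs k))
        ((2 : ℝ) ^ k • ContinuousLinearMap.id ℝ X) y :=
      ((hasFDerivAt_id y).sub_const (xs k)).const_smul _
    have hbo := ((hb.differentiable one_ne_zero) ((2 : ℝ) ^ k • (y - xs k))).hasFDerivAt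
    have hd := (hbo.comp y hin).const_mul (δ k)
    have : HasFDerivAt (u k) _ y := hd
    rw [this.fderiv, norm_smul, ContinuousLinearMap.comp_smul, norm_smul,
      ContinuousLinearMap.comp_id, norm_pow, Real.norm_ofNat, Real.norm_of_nonneg (hδ0 k).le,
      ← mul_assoc]
    have : δ k * 2 ^ k = ε' * (1 / 2) ^ k := by
      simp only [hδ]; rw [mul_assoc, ← mul_pow]; norm_num
    rw [this]
    exact mul_le_mul_of_nonneg_left (hbD _) (by positivity)
  have hsum : ∀ y, Summable fun k => u k y := fun y =>
    Summable.of_norm_bounded hs1.summable fun k => hu k y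
  have hσ : ContDiff ℝ 1 fun y => ∑' k, u k y := by
    refine contDiff_tsum (𝕜 := ℝ) (f := u) (N := 1)
      (v := fun j k => if j = 0 then δ k * C else ε' * (1 / 2) ^ k * C) huc ?_ ?_
    · intro j hj
      by_cases h : j = 0
      · simpa [h] using hs1.summable
      · simpa [h] using hs2.summable
    · intro j k y hj
      have : j ≤ 1 := by exact_mod_cast hj
      interval_cases j
      · simpa using hu k y
      · rw [norm_iteratedFDeriv_one]
        simpa using huD k y
  have hunif := tendstoUniformly_tsum_nat (f := u) hs1.summable fun k y => hu k y
  have hGs : ∀ n y, G n y = g y - ∑ k ∈ Finset.range n, u k y := by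
    intro n y
    induction n with
    | zero => simp [G]
    | succ n ih => rw [hG, ih, Finset.sum_range_succ]; ring
  refine ⟨x, hxmem, fun y => -∑' k, u k y, hσ.neg, fun y => ?_, fun y => ?_, fun y hy => ?_⟩
  · rw [abs_neg, ← Real.norm_eq_abs]
    refine (tsum_of_norm_bounded hs1 fun k => hu k y).trans ?_
    nlinarith [mul_nonneg hε'0.le hC]
  · rw [fderiv_fun_neg, norm_neg, fderiv_tsum hs2.summable
      (fun k => (huc k).differentiable one_ne_zero) huD (hsum 0)]
    refine (tsum_of_norm_bounded hs2 fun k => huD k y).trans ?_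
    linarith
  -- Pass to the limit in the almost-minimality of `xs n` for `G n`: lower semicontinuity of `g`,
  -- continuity of the sum, uniform convergence at `xs n` and at `y`, and `δ n` each cost at most `ρ
  -- / 6`.
  · refine le_of_forall_pos_le_add fun ρ hρ => ?_
    have hxw : Filter.Tendsto xs Filter.atTop (𝓝[S] x) :=
      tendsto_nhdsWithin_iff.2 ⟨hx, Filter.Eventually.of_forall hxS⟩
    have e1 := hxw.eventually (hg x hxmem (g x - ρ / 6) (by linarith))
    have e2 := ((hσ.continuous.tendsto x).comp hx).eventually
      (gt_mem_nhds (show (∑' k, u k x) < (∑' k, u k x) + ρ / 6 by linarith))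
    have e3 := Metric.tendstoUniformly_iff.1 hunif (ρ / 6) (by positivity)
    have hδlim : Filter.Tendsto δ Filter.atTop (𝓝 0) := by
      simpa [hδ] using (tendsto_pow_atTop_nhds_zero_of_lt_one (r := (1 / 4 : ℝ)) (by norm_num)
        (by norm_num)).const_mul ε'
    have e4 := hδlim.eventually (gt_mem_nhds (show (0 : ℝ) < ρ / 6 by positivity))
    obtain ⟨n, h1, h2, h3, h4⟩ := (e1.and (e2.and (e3.and e4))).exists
    have h5 := hxmin n y hy
    rw [hGs, hGs] at h5
    have h6 := abs_lt.1 (h3 (xs n))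
    have h7 := abs_lt.1 (h3 y)
    simp only [Function.comp_apply] at h2
    linarith [h6.1, h6.2, h7.1, h7.2]

/-! ### Directional mean value inequality in the model space -/

/-- There are `C^1` increasing functions on `ℝ`, vanishing at `0`, of slope at least `s`
everywhere, almost `s * t` for positive `t`, and very negative at a given `-η`. -/
theorem exists_steep_barrier (s T κ η : ℝ) (hκ : 0 < κ) (hη : 0 < η) :
    ∃ θ θ' : ℝ → ℝ, ContDiff ℝ 1 θ ∧ (∀ t, HasDerivAt θ (θ' t) t) ∧ (∀ t, s ≤ θ' t) ∧ θ 0 = 0 ∧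
      (∀ t, θ t ≤ s * t + κ) ∧ θ (-η) ≤ -T := by
  -- The rate `l` makes `κ * exp (l * η)` at least `T + |s| * η + κ`; the `max` keeps the extra
  -- slope nonnegative.
  set l : ℝ := max 0 (Real.log ((T + |s| * η + κ) / κ) / η) with hl
  have hl0 : 0 ≤ l := le_max_left _ _
  refine ⟨fun t => s * t + κ * (1 - Real.exp (-(l * t))),
    fun t => s + κ * (l * Real.exp (-(l * t))), ?_, fun t => ?_, fun t => ?_, by simp,
    fun t => ?_, ?_⟩
  · fun_prop
  · have h1 : HasDerivAt (fun t : ℝ => -(l * t)) (-l) t := by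
      simpa using ((hasDerivAt_id' t).const_mul l).fun_neg
    have h2 := ((hasDerivAt_id t).const_mul s).add ((h1.exp.const_sub 1).const_mul κ)
    exact h2.congr_deriv (by ring)
  · have : 0 ≤ κ * (l * Real.exp (-(l * t))) := by positivity
    linarith
  · have := (Real.exp_pos (-(l * t))).le
    nlinarith
  · have h1 : (T + |s| * η + κ) / κ ≤ Real.exp (l * η) := by
      rcases le_or_gt ((T + |s| * η + κ) / κ) 0 with h | h
      · exact h.trans (Real.exp_pos _).le
      · rw [← Real.log_le_iff_le_exp h, ← div_le_iff₀ hη]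
        exact le_max_right _ _
    rw [div_le_iff₀ hκ] at h1
    have h2 : -(l * -η) = l * η := by ring
    have h3 : -s * η ≤ |s| * η := mul_le_mul_of_nonneg_right (neg_le_abs s) hη.le
    simp only [h2]
    linarith

/-- A directional mean value inequality: if every `C^1` function touching the lower semicontinuous
function `f` from below has derivative at most `A` in the direction `w`, then `f` increases by at
most `A` along the segment from `z` to `z + w`. -/
theorem HasC1LipschitzBump.sub_le_of_forall_fderiv_le {X : Type*} [NormedAddCommGroup X]
    [NormedSpace ℝ X] [CompleteSpace X] (hX : HasC1LipschitzBump X) {U : Set X} (hU : IsOpen U)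
    {f : X → ℝ} (hf : LowerSemicontinuousOn f U) {m : ℝ} (hm : ∀ x ∈ U, m ≤ f x) {z w : X}
    (hw : w ≠ 0) (hseg : ∀ t ∈ Icc (0 : ℝ) 1, z + t • w ∈ U) {A : ℝ}
    (hA : ∀ x ∈ U, ∀ G : X → ℝ, ContDiff ℝ 1 G → IsLocalMin (fun y => f y - G y) x →
      fderiv ℝ G x w ≤ A) :
    f (z + w) - f z ≤ A := by
  by_contra! hlt
  obtain ⟨ℓ, hℓ⟩ := SeparatingDual.exists_eq_one (R := ℝ) hw
  obtain ⟨b, -, hb, hb0, hb1, -, -, -⟩ := hX.exists_normalized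
  obtain ⟨s, hAs, hs⟩ := exists_between hlt
  have hzU : z ∈ U := by simpa using hseg 0 (by simp)
  have hzwU : z + w ∈ U := by simpa using hseg 1 (by simp)
  set κ : ℝ := (f (z + w) - f z - s) / 4 with hκdef
  have hκ : 0 < κ := by rw [hκdef]; linarith
  -- a thickening of the segment inside `U`
  have hK : IsCompact ((fun t : ℝ => z + t • w) '' Icc 0 1) :=
    isCompact_Icc.image (by fun_prop)
  obtain ⟨r, hr, hrU⟩ := hK.exists_cthickening_subset_open hU
    (by rintro _ ⟨t, ht, rfl⟩; exact hseg t ht)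
  have hnear : ∀ x, ∀ t ∈ Icc (0 : ℝ) 1, ‖x - (z + t • w)‖ ≤ r → x ∈ U := by
    intro x t ht hx
    refine hrU (Metric.mem_cthickening_of_dist_le x _ r _ (mem_image_of_mem _ ht) ?_)
    rwa [dist_eq_norm]
  obtain ⟨r', hr', hr'f⟩ : ∃ r' > 0, ∀ x, ‖x - (z + w)‖ ≤ r' → f (z + w) - κ < f x := by
    have h1 := hf (z + w) hzwU (f (z + w) - κ) (by linarith)
    rw [hU.nhdsWithin_eq hzwU] at h1
    obtain ⟨r', hr', h⟩ := Metric.nhds_basis_closedBall.eventually_iff.1 h1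
    exact ⟨r', hr', fun x hx => h (by rwa [Metric.mem_closedBall, dist_eq_norm])⟩
  set ρ : ℝ := min (r / 2) r' with hρdef
  have hρ : 0 < ρ := by positivity
  have hwpos : 0 < ‖w‖ := norm_pos_iff.2 hw
  set η : ℝ := min 1 (r / 2 / ‖w‖) with hηdef
  have hη : 0 < η := by positivity
  have hη1 : η ≤ 1 := min_le_left _ _
  have hηw : η * ‖w‖ ≤ r / 2 := by
    rw [← le_div_iff₀ hwpos]; exact min_le_right _ _
  -- `P` projects `x - z` onto the kernel of `ℓ` along `w`, so `(ℓ, P)` are cylindrical coordinates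
  -- around the segment, whose axis is `P = 0`.
  let P : X → X := fun x => (x - z) - ℓ (x - z) • w
  have hPc : ContDiff ℝ 1 P := by
    have : ContDiff ℝ 1 fun x : X => ℓ (x - z) := ℓ.contDiff.comp (contDiff_id.sub contDiff_const)
    exact (contDiff_id.sub contDiff_const).sub (this.smul contDiff_const)
  have hPd : ∀ x, HasFDerivAt P (ContinuousLinearMap.id ℝ X - ℓ.smulRight w) x := by
    intro x
    have h1 : HasFDerivAt (fun x : X => x - z) (ContinuousLinearMap.id ℝ X) x :=
      (hasFDerivAt_id x).sub_const z
    have h2 : HasFDerivAt (fun x : X => ℓ (x - z)) ℓ x := by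
      have := ℓ.hasFDerivAt.comp x h1
      rwa [ContinuousLinearMap.comp_id] at this
    exact h1.sub (h2.smul_const w)
  have hdec : ∀ x, x = z + ℓ (x - z) • w + P x := fun x => by simp only [P]; abel
  let S : Set X := {x | -η ≤ ℓ (x - z) ∧ ℓ (x - z) ≤ 1 ∧ ‖P x‖ ≤ ρ}
  have hℓc : Continuous fun x => ℓ (x - z) := by fun_prop
  have hS : IsClosed S :=
    (isClosed_le continuous_const hℓc).inter
      ((isClosed_le hℓc continuous_const).inter (isClosed_le hPc.continuous.norm continuous_const))
  have hSU : S ⊆ U := by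
    rintro x ⟨h1, h2, h3⟩
    have h3' : ‖P x‖ ≤ r / 2 := h3.trans (min_le_left _ _)
    rcases le_total 0 (ℓ (x - z)) with h | h
    · refine hnear x _ ⟨h, h2⟩ ?_
      nth_rewrite 1 [hdec x]
      rw [add_sub_cancel_left]
      linarith
    · refine hnear x 0 (by simp) ?_
      nth_rewrite 1 [hdec x]
      rw [zero_smul, add_zero, add_assoc, add_sub_cancel_left]
      refine (norm_add_le _ _).trans ?_
      rw [norm_smul, Real.norm_eq_abs, abs_of_nonpos h]
      nlinarith
  obtain ⟨θ, θ', hθ, hθd, hθs, hθ0, hθle, hθη⟩ :=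
    exists_steep_barrier s (f z - m + κ) κ η hκ hη
  set C : ℝ := f z - m + |s| + 2 * κ with hCdef
  have hC : 0 ≤ C := by
    have := hm z hzU
    have := abs_nonneg s
    rw [hCdef]; linarith
  -- This penalty vanishes on the axis, equals `1` where `‖P x‖ ≥ ρ`, and is constant in the
  -- direction `w`, so it does not affect the slope of `H` along `w`. The square makes it
  -- nonnegative although `b` may exceed `1`.
  let β : X → ℝ := fun x => (1 - b (ρ⁻¹ • P x)) ^ 2
  have hβ : ContDiff ℝ 1 β :=
    (contDiff_const.sub (hb.comp (contDiff_const.smul hPc))).pow 2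
  let H : X → ℝ := fun x => θ (ℓ (x - z)) - C * β x
  have hHc : ContDiff ℝ 1 H :=
    (hθ.comp (ℓ.contDiff.comp (contDiff_id.sub contDiff_const))).sub (contDiff_const.mul hβ)
  have hHw : ∀ x, s ≤ fderiv ℝ H x w := by
    intro x
    have h1 : HasFDerivAt (fun x : X => x - z) (ContinuousLinearMap.id ℝ X) x :=
      (hasFDerivAt_id x).sub_const z
    have h2 : HasFDerivAt (fun x : X => ℓ (x - z)) ℓ x := by
      have := ℓ.hasFDerivAt.comp x h1
      rwa [ContinuousLinearMap.comp_id] at this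
    have h3 : HasFDerivAt (fun x : X => θ (ℓ (x - z))) (θ' (ℓ (x - z)) • ℓ) x :=
      (hθd _).comp_hasFDerivAt x h2
    have h4 := ((hPd x).const_smul ρ⁻¹)
    have h5 := (((hb.differentiable one_ne_zero) (ρ⁻¹ • P x)).hasFDerivAt.comp x h4)
    have h6 : HasFDerivAt β _ x := (h5.const_sub 1).pow 2
    have h7 : HasFDerivAt H _ x := h3.sub (h6.const_mul C)
    rw [h7.fderiv]
    simpa [hℓ] using hθs _
  set gap : ℝ := κ with hgap
  have hglsc : LowerSemicontinuousOn (fun x => f x + -H x) S :=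
    (hf.mono hSU).add (hHc.continuous.neg.lowerSemicontinuous.lowerSemicontinuousOn S)
  have hβ0 : ∀ x, 0 ≤ β x := fun x => sq_nonneg _
  have hθS : ∀ x ∈ S, θ (ℓ (x - z)) ≤ |s| + κ := by
    rintro x ⟨h1, h2, -⟩
    refine (hθle _).trans ?_
    have : s * ℓ (x - z) ≤ |s| * 1 := by
      refine (le_abs_self _).trans ?_
      rw [abs_mul]
      exact mul_le_mul_of_nonneg_left (abs_le.2 ⟨by linarith, h2⟩) (abs_nonneg s)
    linarith
  have hzS : z ∈ S := by simp [S, P, hη.le, hρ.le]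
  obtain ⟨x, hxS, τ, hτ, hτb, hτd, hmin⟩ := hX.exists_perturbation_attains_min hS ⟨z, hzS⟩ hglsc
    ⟨m - (|s| + κ), fun x hx => by
      have h1 := hm x (hSU hx)
      have h2 := hθS x hx
      have h3 := mul_nonneg hC (hβ0 x)
      simp only [H]; linarith⟩
    (show 0 < min (κ / 3) ((s - A) / 2 / ‖w‖) by
      have : 0 < s - A := by linarith
      positivity)
  have hτκ : ∀ y, |τ y| ≤ κ / 3 := fun y => (hτb y).trans (min_le_left _ _)
  have hxz : f x + -H x < f z + κ := by
    have h1 := hmin z hzS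
    have h2 : H z = 0 := by simp [H, hθ0, β, P, hb0]
    have h3 := abs_le.1 (hτκ x)
    have h4 := abs_le.1 (hτκ z)
    rw [h2] at h1
    linarith [h3.1, h4.2]
  have hfx := hm x (hSU hxS)
  have hCβ := mul_nonneg hC (hβ0 x)
  -- The minimiser avoids the three faces of the cylinder, on each of which `f - H ≥ f z + κ`: at
  -- the bottom by the steepness of `θ`, at the top because `f` exceeds `f (z + w) - κ` there and `f
  -- (z + w) = f z + s + 4κ`, on the side by the choice of `C`.
  obtain ⟨hx1, hx2, hx3⟩ := hxS
  have hx1' : -η < ℓ (x - z) := by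
    refine lt_of_le_of_ne hx1 fun h => ?_
    simp only [H, ← h] at hxz
    linarith
  have hx2' : ℓ (x - z) < 1 := by
    refine lt_of_le_of_ne hx2 fun h => ?_
    have h1 := hr'f x (by
      nth_rewrite 1 [hdec x]
      rw [h, one_smul, add_sub_cancel_left]
      exact hx3.trans (min_le_right _ _))
    have h2 := hθle 1
    simp only [H, h] at hxz
    linarith
  have hx3' : ‖P x‖ < ρ := by
    refine lt_of_le_of_ne hx3 fun h => ?_
    have h1 : β x = 1 := by
      simp only [β]
      rw [hb1 _ (by rw [norm_smul, h, norm_inv, Real.norm_of_nonneg hρ.le,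
        inv_mul_cancel₀ hρ.ne'])]
      norm_num
    have h2 := hθS x ⟨hx1, hx2, hx3⟩
    simp only [H, h1] at hxz
    linarith
  have hSx : S ∈ 𝓝 x := by
    have e1 := hℓc.continuousAt.eventually (lt_mem_nhds hx1')
    have e2 := hℓc.continuousAt.eventually (gt_mem_nhds hx2')
    have e3 := hPc.continuous.norm.continuousAt.eventually (gt_mem_nhds hx3')
    filter_upwards [e1, e2, e3] with y h1 h2 h3 using ⟨h1.le, h2.le, h3.le⟩
  have hloc : IsLocalMin (fun y => f y - (H y - τ y)) x := by
    filter_upwards [hSx] with y hy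
    have := hmin y hy
    linarith
  have hfin := hA x (hSU (mem_of_mem_nhds hSx)) (fun y => H y - τ y) (hHc.sub hτ) hloc
  rw [fderiv_fun_sub (hHc.differentiable one_ne_zero x) (hτ.differentiable one_ne_zero x)] at hfin
  have h1 := hHw x
  have h2 : fderiv ℝ τ x w ≤ (s - A) / 2 := by
    refine (le_abs_self _).trans ?_
    rw [← Real.norm_eq_abs]
    refine ((fderiv ℝ τ x).le_opNorm w).trans ?_
    rw [← le_div_iff₀ hwpos]
    exact (hτd x).trans (min_le_right _ _)
  simp only [sub_apply] at hfin
  linarith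

/-! ### Test functions and subdifferentials in charts -/

/-- In a `C^1` manifold modeled on a space with a bump function, every `C^1` function on the model
space coincides, near a given point and through a given chart, with a global `C^1` function. -/
theorem HasC1LipschitzBump.exists_contMDiff_eventuallyEq {X : Type*} [NormedAddCommGroup X]
    [NormedSpace ℝ X] (hX : HasC1LipschitzBump X) {M : Type*} [TopologicalSpace M] [RegularSpace M]
    [ChartedSpace X M] {φ : OpenPartialHomeomorph M X}
    (hφ : φ ∈ IsManifold.maximalAtlas 𝓘(ℝ, X) 1 M) {x : M} (hx : x ∈ φ.source) {G : X → ℝ}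
    (hG : ContDiff ℝ 1 G) :
    ∃ g : M → ℝ, ContMDiff 𝓘(ℝ, X) 𝓘(ℝ, ℝ) 1 g ∧ g =ᶠ[𝓝 x] G ∘ φ := by
  classical
  obtain ⟨b, -, hb, hb0, hb1, -, -, -⟩ := hX.exists_normalized
  obtain ⟨C, ⟨hCx, hCcl⟩, hCs⟩ := (closed_nhds_basis x).mem_iff.1 (φ.open_source.mem_nhds hx)
  have hpre : φ.target ∩ φ.symm ⁻¹' C ∈ 𝓝 (φ x) :=
    Filter.inter_mem (φ.open_target.mem_nhds (φ.map_source hx))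
      ((φ.continuousAt_symm (φ.map_source hx)) (by simpa [φ.left_inv hx] using hCx))
  obtain ⟨r, hr, hrC⟩ := Metric.mem_nhds_iff.1 hpre
  -- Since `2 * b` exceeds `1` near the centre, composing with `Real.smoothTransition` flattens the
  -- bump to the constant `1` on a neighbourhood, as needed for the germ of `G` to be preserved.
  let χ : X → ℝ := fun v => Real.smoothTransition (2 * b (r⁻¹ • (v - φ x)))
  have hχ : ContDiff ℝ 1 χ := Real.smoothTransition.contDiff.comp
    (contDiff_const.mul (hb.comp (contDiff_const.smul (contDiff_id.sub contDiff_const))))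
  have hχout : ∀ v, v ∉ Metric.ball (φ x) r → χ v = 0 := by
    intro v hv
    rw [Metric.mem_ball, dist_eq_norm, not_lt] at hv
    simp only [χ]
    rw [hb1 _ (by rw [norm_smul, norm_inv, Real.norm_of_nonneg hr.le, ← div_eq_inv_mul]
                  exact (one_le_div₀ hr).2 hv), mul_zero, Real.smoothTransition.zero]
  have hχin : ∀ᶠ v in 𝓝 (φ x), χ v = 1 := by
    have hc : ContinuousAt (fun v => 2 * b (r⁻¹ • (v - φ x))) (φ x) :=
      (continuous_const.mul (hb.continuous.comp (by fun_prop))).continuousAt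
    filter_upwards [hc.eventually (lt_mem_nhds (show (1 : ℝ) < _ by simp [hb0]))] with v hv
    exact Real.smoothTransition.one_of_one_le hv.le
  let g : M → ℝ := fun y => if y ∈ φ.source then χ (φ y) * G (φ y) else 0
  have hgeq : ∀ y ∈ φ.source, g =ᶠ[𝓝 y] fun y => χ (φ y) * G (φ y) := fun y hy => by
    filter_upwards [φ.open_source.mem_nhds hy] with y' hy'
    simp [g, hy']
  have hsupp : tsupport g ⊆ C := by
    refine closure_minimal (fun y hy => ?_) hCcl
    have hys : y ∈ φ.source := by
      by_contra h
      exact hy (by simp [g, h])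
    have hyb : φ y ∈ Metric.ball (φ x) r := by
      by_contra h
      exact hy (by simp [g, hχout _ h])
    have := (hrC hyb).2
    rwa [mem_preimage, φ.left_inv hys] at this
  refine ⟨g, contMDiff_of_tsupport fun y hy => ?_, ?_⟩
  · have hys := hCs (hsupp hy)
    refine ContMDiffAt.congr_of_eventuallyEq ?_ (hgeq y hys)
    have h1 := (contMDiffOn_of_mem_maximalAtlas hφ).contMDiffAt (φ.open_source.mem_nhds hys)
    exact ((hχ.mul hG).contMDiff.contMDiffAt (x := φ y)).comp y h1
  · filter_upwards [hgeq x hx, (φ.continuousAt hx).eventually hχin] with y h1 h2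
    rw [h1, h2, one_mul, Function.comp_apply]

/-- The differential of the inverse of a chart, as an endomorphism of the model space. -/
def symmDeriv {X : Type*} [NormedAddCommGroup X] [NormedSpace ℝ X]
    {M : Type*} [TopologicalSpace M] [ChartedSpace X M] (φ : OpenPartialHomeomorph M X) (u : X) :
    X →L[ℝ] X :=
  mfderiv 𝓘(ℝ, X) 𝓘(ℝ, X) φ.symm u

/-- Lower semicontinuity at the centre already forces a local lower bound, which is what the
variational principle requires on the cylinder. -/
theorem exists_ball_lowerSemicontinuousOn {X : Type*} [NormedAddCommGroup X]
    {M : Type*} [TopologicalSpace M] {φ : OpenPartialHomeomorph M X} {S : Set M} (hS : IsOpen S) {f : M → ℝ}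
    (hf : LowerSemicontinuousOn f S) {u₀ : X} (hu₀ : u₀ ∈ φ.target) (hu₀S : φ.symm u₀ ∈ S) :
    ∃ r > 0, Metric.ball u₀ r ⊆ φ.target ∧ MapsTo φ.symm (Metric.ball u₀ r) S ∧
      LowerSemicontinuousOn (fun u => f (φ.symm u)) (Metric.ball u₀ r) ∧
      ∀ u ∈ Metric.ball u₀ r, f (φ.symm u₀) - 1 ≤ f (φ.symm u) := by
  have h1 := hf _ hu₀S (f (φ.symm u₀) - 1) (by linarith)
  rw [hS.nhdsWithin_eq hu₀S] at h1
  have h2 := (φ.continuousAt_symm hu₀).eventually (h1.and (hS.mem_nhds hu₀S))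
  obtain ⟨r, hr, h⟩ := Metric.mem_nhds_iff.1
    (Filter.inter_mem (φ.open_target.mem_nhds hu₀) h2)
  have ht : Metric.ball u₀ r ⊆ φ.target := fun u hu => (h hu).1
  have hm : MapsTo φ.symm (Metric.ball u₀ r) S := fun u hu => (h hu).2.2
  exact ⟨r, hr, ht, hm, hf.comp (φ.continuousOn_symm.mono ht) hm, fun u hu => (h hu).2.1.le⟩

section

variable {X : Type*} [NormedAddCommGroup X] [NormedSpace ℝ X]
  {M : Type*} [TopologicalSpace M] [ChartedSpace X M]
  {φ : OpenPartialHomeomorph M X}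

theorem mdifferentiable_of_mem_maximalAtlas (hφ : φ ∈ IsManifold.maximalAtlas 𝓘(ℝ, X) 1 M) :
    φ.MDifferentiable 𝓘(ℝ, X) 𝓘(ℝ, X) :=
  ⟨(contMDiffOn_of_mem_maximalAtlas hφ).mdifferentiableOn one_ne_zero,
    (contMDiffOn_symm_of_mem_maximalAtlas hφ).mdifferentiableOn one_ne_zero⟩

theorem symmDeriv_mfderiv (hφ : φ ∈ IsManifold.maximalAtlas 𝓘(ℝ, X) 1 M) {u : X}
    (hu : u ∈ φ.target) (v : X) :
    symmDeriv φ u ((mfderiv 𝓘(ℝ, X) 𝓘(ℝ, X) φ (φ.symm u) : X →L[ℝ] X) v) = v := by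
  have h := (mdifferentiable_of_mem_maximalAtlas hφ).symm_comp_deriv (φ.map_target hu)
  have h2 := DFunLike.congr_fun h v
  have h3 : symmDeriv φ (φ (φ.symm u))
      ((mfderiv 𝓘(ℝ, X) 𝓘(ℝ, X) φ (φ.symm u) : X →L[ℝ] X) v) = v := h2
  rwa [φ.right_inv hu] at h3

/-- A subdifferential of `f` read in a chart comes from a subdifferential of `f` on the manifold. -/
theorem exists_mem_subdifferential (hX : HasC1LipschitzBump X) [RegularSpace M] {S : Set M}
    {f : M → ℝ} (hφ : φ ∈ IsManifold.maximalAtlas 𝓘(ℝ, X) 1 M) {u : X} (hu : u ∈ φ.target)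
    {G : X → ℝ} (hG : ContDiff ℝ 1 G) (hmin : IsLocalMin (fun y => f (φ.symm y) - G y) u) :
    ∃ Δ : X →L[ℝ] ℝ, Δ ∈ subdifferential X f S (φ.symm u) ∧
      ∀ v, Δ (symmDeriv φ u v) = fderiv ℝ G u v := by
  have hxs := φ.map_target hu
  obtain ⟨g, hg, hgG⟩ := hX.exists_contMDiff_eventuallyEq hφ hxs hG
  refine ⟨(mfderiv 𝓘(ℝ, X) 𝓘(ℝ, ℝ) g (φ.symm u) : X →L[ℝ] ℝ), ⟨g, hg, ?_, fun v => rfl⟩,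
    fun v => ?_⟩
  · refine IsLocalMin.on ?_ S
    have h1 : Filter.Tendsto φ (𝓝 (φ.symm u)) (𝓝 u) := by
      have := φ.continuousAt hxs
      rwa [ContinuousAt, φ.right_inv hu] at this
    have h2 := hgG.self_of_nhds
    rw [Function.comp_apply, φ.right_inv hu] at h2
    filter_upwards [h1.eventually hmin, hgG, φ.open_source.mem_nhds hxs] with y hy1 hy2 hy3
    rw [φ.left_inv hy3] at hy1
    rw [h2, hy2]
    exact hy1
  · have h1 : (g ∘ φ.symm) =ᶠ[𝓝 u] G := by
      filter_upwards [(φ.continuousAt_symm hu).eventually hgG, φ.open_target.mem_nhds hu]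
        with y hy1 hy2
      rw [Function.comp_apply, hy1, Function.comp_apply, φ.right_inv hy2]
    have h2 : mfderiv 𝓘(ℝ, X) 𝓘(ℝ, ℝ) (g ∘ φ.symm) u =
        (mfderiv 𝓘(ℝ, X) 𝓘(ℝ, ℝ) g (φ.symm u)).comp (mfderiv 𝓘(ℝ, X) 𝓘(ℝ, X) φ.symm u) :=
      mfderiv_comp u (hg.mdifferentiableAt one_ne_zero)
        ((mdifferentiable_of_mem_maximalAtlas hφ).mdifferentiableAt_symm hu)
    have h3 : (mfderiv 𝓘(ℝ, X) 𝓘(ℝ, ℝ) (g ∘ φ.symm) u : X →L[ℝ] ℝ) = fderiv ℝ G u := by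
      rw [mfderiv_eq_fderiv]
      exact h1.fderiv_eq
    rw [← h3]
    exact (DFunLike.congr_fun h2 v).symm

/-! ### Finsler norms in charts and the infinitesimal estimate -/

namespace PalaisFinsler

variable [IsManifold 𝓘(ℝ, X) 1 M] (F : PalaisFinsler X M)

/-- The norm of the tangent space at `x`, as a seminorm on the model space. -/
def nrmAt (x : M) : Seminorm ℝ X := F.nrm x

theorem exists_nrmAt_equiv (hφ : φ ∈ IsManifold.maximalAtlas 𝓘(ℝ, X) 1 M) {u : X}
    (hu : u ∈ φ.target) :
    ∃ C : ℝ, 1 ≤ C ∧ ∀ v : X, C⁻¹ * ‖v‖ ≤ F.nrmAt (φ.symm u) (symmDeriv φ u v) ∧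
      F.nrmAt (φ.symm u) (symmDeriv φ u v) ≤ C * ‖v‖ := by
  obtain ⟨C, hC, h⟩ := F.equiv_nrm φ hφ (φ.symm u) (φ.map_target hu)
  have h' : ∀ v : X, C⁻¹ * ‖v‖ ≤
      F.nrmAt (φ.symm (φ (φ.symm u))) (symmDeriv φ (φ (φ.symm u)) v) ∧
      F.nrmAt (φ.symm (φ (φ.symm u))) (symmDeriv φ (φ (φ.symm u)) v) ≤ C * ‖v‖ := h
  rw [φ.right_inv hu] at h'
  exact ⟨C, hC, h'⟩

theorem eventually_nrmAt_le (hφ : φ ∈ IsManifold.maximalAtlas 𝓘(ℝ, X) 1 M) {u₀ : X}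
    (hu₀ : u₀ ∈ φ.target) {ε : ℝ} (hε : 0 < ε) :
    ∀ᶠ u in 𝓝 u₀, ∀ v : X, F.nrmAt (φ.symm u) (symmDeriv φ u v) ≤
      (1 + ε) * F.nrmAt (φ.symm u₀) (symmDeriv φ u₀ v) := by
  obtain ⟨W, hWo, hxW, -, hW⟩ := F.palais φ hφ (φ.symm u₀) (φ.map_target hu₀) ε hε
  have h' : ∀ x ∈ W, ∀ v : X, F.nrmAt (φ.symm (φ x)) (symmDeriv φ (φ x) v) ≤
      (1 + ε) * F.nrmAt (φ.symm (φ (φ.symm u₀))) (symmDeriv φ (φ (φ.symm u₀)) v) :=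
    fun x hx v => (hW x hx v).2
  rw [φ.right_inv hu₀] at h'
  filter_upwards [φ.open_target.mem_nhds hu₀,
    (φ.continuousAt_symm hu₀).eventually (hWo.mem_nhds hxW)] with u hu huW v
  have := h' _ huW v
  rwa [φ.right_inv hu] at this

theorem dualNorm_nonneg (x : M) (Δ : TangentSpace 𝓘(ℝ, X) x →L[ℝ] ℝ) : 0 ≤ F.dualNorm x Δ := by
  refine Real.sSup_nonneg ?_
  rintro _ ⟨v, -, rfl⟩
  exact abs_nonneg _

/-- The point is that the supremum is over a bounded set: by (P1), Finsler unit vectors are bounded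
in `X`, where the functional is continuous. The rest is homogeneity. -/
theorem abs_apply_le_dualNorm_mul (x : M) (Δ : X →L[ℝ] ℝ) (v : X) :
    |Δ v| ≤ F.dualNorm x Δ * F.nrmAt x v := by
  have hφ := IsManifold.chart_mem_maximalAtlas (I := 𝓘(ℝ, X)) (n := 1) x
  set φ := chartAt X x
  have hxs : x ∈ φ.source := mem_chart_source X x
  obtain ⟨C, hC, hCv⟩ := F.exists_nrmAt_equiv hφ (φ.map_source hxs)
  rw [φ.left_inv hxs] at hCv
  have hbd : BddAbove {r : ℝ | ∃ v : TangentSpace 𝓘(ℝ, X) x, F.nrm x v = 1 ∧ r = |Δ v|} := by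
    refine ⟨‖Δ‖ * (‖symmDeriv φ (φ x)‖ * C), ?_⟩
    rintro _ ⟨v, hv, rfl⟩
    have hv' : F.nrmAt x v = 1 := hv
    set w : X := (mfderiv 𝓘(ℝ, X) 𝓘(ℝ, X) φ (φ.symm (φ x)) : X →L[ℝ] X) v
    have hw : symmDeriv φ (φ x) w = v := symmDeriv_mfderiv hφ (φ.map_source hxs) v
    have h1 := (hCv w).1
    rw [hw, hv', inv_mul_le_iff₀ (by linarith), mul_one] at h1
    have h2 : |Δ (symmDeriv φ (φ x) w)| ≤ ‖Δ‖ * (‖symmDeriv φ (φ x)‖ * C) := by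
      rw [← Real.norm_eq_abs]
      refine (Δ.le_opNorm _).trans ?_
      refine mul_le_mul_of_nonneg_left ?_ (norm_nonneg _)
      exact ((symmDeriv φ (φ x)).le_opNorm w).trans
        (mul_le_mul_of_nonneg_left h1 (norm_nonneg _))
    rw [hw] at h2
    exact h2
  rcases (apply_nonneg (F.nrmAt x) v).eq_or_lt with h | h
  · have : v = 0 := F.eq_zero_of_nrm x v h.symm
    simp [this]
  · have h1 : |Δ ((F.nrmAt x v)⁻¹ • v)| ≤ F.dualNorm x Δ := by
      refine le_csSup hbd ⟨(F.nrmAt x v)⁻¹ • v, ?_, rfl⟩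
      change F.nrmAt x ((F.nrmAt x v)⁻¹ • v) = 1
      rw [map_smul_eq_mul, norm_inv, Real.norm_of_nonneg h.le, inv_mul_cancel₀ h.ne']
    rw [map_smul, smul_eq_mul, abs_mul, abs_inv, abs_of_pos h, inv_mul_le_iff₀ h] at h1
    rwa [mul_comm]

/-- If `K < 0`, no point of `S` has a subdifferential, so the directional inequality holds vacuously
with any bound `A`, even one smaller than the actual increment. When `X` is trivial there is no
direction to use, but points are isolated and the zero function is a test function. -/
theorem nonneg_of_dualNorm_le [CompleteSpace X] (hX : HasC1LipschitzBump X) [RegularSpace M]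
    {S : Set M} (hS : IsOpen S) (hne : S.Nonempty) {f : M → ℝ} (hf : LowerSemicontinuousOn f S)
    {K : ℝ} (hK : ∀ x ∈ S, ∀ ξ ∈ subdifferential X f S x, F.dualNorm x ξ ≤ K) : 0 ≤ K := by
  obtain ⟨x₀, hx₀⟩ := hne
  have hφ := IsManifold.chart_mem_maximalAtlas (I := 𝓘(ℝ, X)) (n := 1) x₀
  set φ := chartAt X x₀
  have hxs : x₀ ∈ φ.source := mem_chart_source X x₀
  obtain ⟨r, hr, ht, hm, hl, hb⟩ := exists_ball_lowerSemicontinuousOn hS hf (φ.map_source hxs)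
    (by rwa [φ.left_inv hxs])
  by_contra! hneg
  have hno : ∀ u ∈ Metric.ball (φ x₀) r, ∀ G : X → ℝ, ContDiff ℝ 1 G →
      ¬ IsLocalMin (fun y => f (φ.symm y) - G y) u := by
    intro u hu G hG hmin
    obtain ⟨Δ, hΔ, -⟩ := exists_mem_subdifferential (S := S) hX hφ (ht hu) hG hmin
    have := hK _ (hm hu) Δ hΔ
    have := F.dualNorm_nonneg (φ.symm u) Δ
    linarith
  rcases subsingleton_or_nontrivial X with hs | hn
  · refine hno (φ x₀) (Metric.mem_ball_self hr) 0 contDiff_const ?_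
    exact Filter.Eventually.of_forall fun y => by rw [Subsingleton.elim y (φ x₀)]
  · obtain ⟨v, hv⟩ := exists_ne (0 : X)
    have hv' : 0 < ‖v‖ := norm_pos_iff.2 hv
    set w : X := (r / 2 / ‖v‖) • v
    have hw : w ≠ 0 := smul_ne_zero (by positivity) hv
    have hwn : ‖w‖ = r / 2 := by
      rw [norm_smul, Real.norm_of_nonneg (by positivity), div_mul_cancel₀ _ hv'.ne']
    have := hX.sub_le_of_forall_fderiv_le Metric.isOpen_ball hl hb (z := φ x₀) hw (fun t ht => by
      rw [Metric.mem_ball, dist_self_add_left, norm_smul, Real.norm_of_nonneg ht.1, hwn]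
      nlinarith [ht.2]) (A := f (φ.symm (φ x₀ + w)) - f (φ.symm (φ x₀)) - 1)
      (fun u hu G hG hmin => absurd hmin (hno u hu G hG))
    linarith

/-- Infinitesimally at each point, `f` is almost `K`-Lipschitz for the Finsler norm. -/
theorem eventually_abs_sub_le [CompleteSpace X] (hX : HasC1LipschitzBump X) [RegularSpace M]
    {S : Set M} (hS : IsOpen S) {f : M → ℝ} (hf : LowerSemicontinuousOn f S)
    {K : ℝ} (hK0 : 0 ≤ K) (hK : ∀ x ∈ S, ∀ ξ ∈ subdifferential X f S x, F.dualNorm x ξ ≤ K)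
    (hφ : φ ∈ IsManifold.maximalAtlas 𝓘(ℝ, X) 1 M) {u₀ : X} (hu₀ : u₀ ∈ φ.target)
    (hu₀S : φ.symm u₀ ∈ S) {ε : ℝ} (hε : 0 < ε) :
    ∀ᶠ u in 𝓝 u₀, |f (φ.symm u) - f (φ.symm u₀)| ≤
      K * ((1 + ε) * F.nrmAt (φ.symm u₀) (symmDeriv φ u₀ (u - u₀))) := by
  obtain ⟨r, hr, ht, hm, hl, hb⟩ := exists_ball_lowerSemicontinuousOn hS hf hu₀ hu₀S
  obtain ⟨r', hr', hr'P⟩ := Metric.eventually_nhds_iff_ball.1 (F.eventually_nrmAt_le hφ hu₀ hε)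
  set ρ := min r r' with hρ
  have hρ0 : 0 < ρ := lt_min hr hr'
  have h1 : Metric.ball u₀ ρ ⊆ Metric.ball u₀ r := Metric.ball_subset_ball (min_le_left _ _)
  have h2 : Metric.ball u₀ ρ ⊆ Metric.ball u₀ r' := Metric.ball_subset_ball (min_le_right _ _)
  have key : ∀ z w : X, z ∈ Metric.ball u₀ ρ → z + w ∈ Metric.ball u₀ ρ →
      f (φ.symm (z + w)) - f (φ.symm z) ≤
        K * ((1 + ε) * F.nrmAt (φ.symm u₀) (symmDeriv φ u₀ w)) := by
    intro z w hz hzw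
    by_cases hw : w = 0
    · simp [hw]
    refine hX.sub_le_of_forall_fderiv_le (f := fun u => f (φ.symm u)) Metric.isOpen_ball
      (hl.mono h1) (fun u hu => hb u (h1 hu)) hw (fun t ht => ?_) (fun u hu G hG hmin => ?_)
    · have := (convex_ball u₀ ρ).add_smul_sub_mem hz hzw ht
      rwa [add_sub_cancel_left] at this
    · obtain ⟨Δ, hΔ, hΔG⟩ := exists_mem_subdifferential (S := S) hX hφ (ht (h1 hu)) hG hmin
      -- The dual norm is bounded by `K` at the moving point `u`; (P2) then replaces the norm at `u`
      -- by the norm at `u₀`, at the price of the factor `1 + ε`.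
      rw [← hΔG]
      refine (le_abs_self _).trans ((F.abs_apply_le_dualNorm_mul (φ.symm u) Δ _).trans ?_)
      exact mul_le_mul (hK _ (hm (h1 hu)) Δ hΔ) (hr'P u (h2 hu) w) (apply_nonneg _ _) hK0
  filter_upwards [Metric.ball_mem_nhds u₀ hρ0] with u hu
  have hc := Metric.mem_ball_self (x := u₀) hρ0
  -- The directional inequality is one-sided, so the segment is travelled both ways; the seminorm is
  -- even.
  have k1 := key u₀ (u - u₀) hc (by rwa [add_sub_cancel])
  have k2 := key u (u₀ - u) hu (by rwa [add_sub_cancel])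
  rw [add_sub_cancel] at k1 k2
  rw [← neg_sub u u₀, map_neg, map_neg_eq_map] at k2
  exact abs_le.2 ⟨by linarith, k1⟩

end PalaisFinsler

end

/-! ### Piecewise `C^1` paths -/

namespace IsPiecewiseC1Path

variable {X : Type*} [NormedAddCommGroup X] [NormedSpace ℝ X]
  {M : Type*} [TopologicalSpace M] [ChartedSpace X M] {c : ℝ → M} {a b : ℝ}

/-- To prove a transitive property of the intervals on which a path is piecewise `C^1`, it suffices
to consider the `C^1` pieces. -/
theorem induction {Q : ℝ → ℝ → Prop} (hc : IsPiecewiseC1Path X c a b) (refl : ∀ x, Q x x)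
    (piece : ∀ s t, s ≤ t → a ≤ s → t ≤ b → ContMDiffOn 𝓘(ℝ, ℝ) 𝓘(ℝ, X) 1 c (Icc s t) → Q s t)
    (trans : ∀ s t u, s ≤ t → t ≤ u → Q s t → Q t u → Q s u) : Q a b := by
  obtain ⟨-, -, n, t, hmono, rfl, rfl, ht⟩ := hc
  have key : ∀ i : Fin (n + 1), Q (t 0) (t i) := by
    intro i
    induction i using Fin.induction with
    | zero => exact refl _
    | succ i ih =>
      exact trans _ _ _ (hmono (Fin.zero_le _)) (hmono (Fin.castSucc_le_succ i)) ih
        (piece _ _ (hmono (Fin.castSucc_le_succ i)) (hmono (Fin.zero_le _))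
          (hmono (Fin.le_last _)) (ht i))
  exact key _

theorem refl (c : ℝ → M) (a : ℝ) : IsPiecewiseC1Path X c a a := by
  refine ⟨le_rfl, by simp, 0, fun _ => a, monotone_const, rfl, rfl, fun i => i.elim0⟩

theorem of_contMDiffOn (hab : a ≤ b) (hc : ContMDiffOn 𝓘(ℝ, ℝ) 𝓘(ℝ, X) 1 c (Icc a b)) :
    IsPiecewiseC1Path X c a b := by
  refine ⟨hab, hc.continuousOn, 1, ![a, b], ?_, rfl, rfl, ?_⟩
  · rw [Fin.monotone_iff_le_succ]
    intro i
    fin_cases i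
    simpa
  · intro i
    fin_cases i
    simpa

theorem snoc (hc : IsPiecewiseC1Path X c a b) {d : ℝ} (hbd : b ≤ d)
    (hd : ContMDiffOn 𝓘(ℝ, ℝ) 𝓘(ℝ, X) 1 c (Icc b d)) : IsPiecewiseC1Path X c a d := by
  obtain ⟨hab, hcont, n, t, hmono, h0, hl, ht⟩ := hc
  refine ⟨hab.trans hbd, ?_, n + 1, Fin.snoc t d, ?_, ?_, ?_, ?_⟩
  · rw [← Icc_union_Icc_eq_Icc hab hbd]
    exact hcont.union_of_isClosed hd.continuousOn isClosed_Icc isClosed_Icc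
  · rw [Fin.monotone_iff_le_succ]
    intro i
    induction i using Fin.lastCases with
    | last => simpa [hl] using hbd
    | cast i =>
      rw [Fin.snoc_castSucc, ← Fin.castSucc_succ, Fin.snoc_castSucc]
      exact hmono (Fin.castSucc_le_succ i)
  · rw [← Fin.castSucc_zero, Fin.snoc_castSucc, h0]
  · simp
  · intro i
    induction i using Fin.lastCases with
    | last => simpa [hl] using hd
    | cast i =>
      rw [Fin.snoc_castSucc, ← Fin.castSucc_succ, Fin.snoc_castSucc]
      exact ht i

theorem trans (hc : IsPiecewiseC1Path X c a b) {d : ℝ} (hd : IsPiecewiseC1Path X c b d) :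
    IsPiecewiseC1Path X c a d := by
  refine hd.induction (Q := fun s t => IsPiecewiseC1Path X c a s → IsPiecewiseC1Path X c a t)
    (fun _ h => h) (fun s t hst _ _ h h' => h'.snoc hst h) (fun s t u _ _ h1 h2 h => h2 (h1 h)) hc

theorem restrict_left (hc : IsPiecewiseC1Path X c a b) {s : ℝ} (hs : s ∈ Icc a b) :
    IsPiecewiseC1Path X c a s := by
  refine hc.induction (Q := fun a b => ∀ s ∈ Icc a b, IsPiecewiseC1Path X c a s) ?_ ?_ ?_ s hs
  · intro x s hs
    rw [Icc_self, mem_singleton_iff] at hs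
    rw [hs]
    exact refl c x
  · intro u v _ _ _ h s hs
    exact of_contMDiffOn hs.1 (h.mono (Icc_subset_Icc_right hs.2))
  · intro u v w huv hvw h1 h2 s hs
    rcases le_total s v with h | h
    · exact h1 s ⟨hs.1, h⟩
    · exact (h1 v ⟨huv, le_rfl⟩).trans (h2 s ⟨h, hs.2⟩)

theorem restrict_right (hc : IsPiecewiseC1Path X c a b) {s : ℝ} (hs : s ∈ Icc a b) :
    IsPiecewiseC1Path X c s b := by
  refine hc.induction (Q := fun a b => ∀ s ∈ Icc a b, IsPiecewiseC1Path X c s b) ?_ ?_ ?_ s hs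
  · intro x s hs
    rw [Icc_self, mem_singleton_iff] at hs
    rw [hs]
    exact refl c x
  · intro u v _ _ _ h s hs
    exact of_contMDiffOn hs.2 (h.mono (Icc_subset_Icc_left hs.1))
  · intro u v w huv hvw h1 h2 s hs
    rcases le_total s v with h | h
    · exact (h1 s ⟨hs.1, h⟩).trans (h2 v ⟨le_rfl, hvw⟩)
    · exact h2 s ⟨h, hs.2⟩

theorem congr (hc : IsPiecewiseC1Path X c a b) {c' : ℝ → M} (h : EqOn c' c (Icc a b)) :
    IsPiecewiseC1Path X c' a b := by
  obtain ⟨hab, hcont, n, t, hmono, rfl, rfl, ht⟩ := hc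
  refine ⟨hab, hcont.congr h, n, t, hmono, rfl, rfl, fun i => (ht i).congr fun x hx => h ?_⟩
  exact ⟨(hmono (Fin.zero_le _)).trans hx.1, hx.2.trans (hmono (Fin.le_last _))⟩

theorem comp_add_right (hc : IsPiecewiseC1Path X c a b) (k : ℝ) :
    IsPiecewiseC1Path X (fun t => c (t + k)) (a - k) (b - k) := by
  refine hc.induction
    (Q := fun a b => IsPiecewiseC1Path X (fun t => c (t + k)) (a - k) (b - k))
    (fun x => refl _ _) (fun s t hst _ _ h => of_contMDiffOn (by linarith) ?_)
    (fun s t u _ _ h1 h2 => h1.trans h2)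
  have h1 : ContMDiffOn 𝓘(ℝ, ℝ) 𝓘(ℝ, ℝ) 1 (fun t : ℝ => t + k) (Icc (s - k) (t - k)) :=
    (contDiff_id.add contDiff_const).contMDiff.contMDiffOn
  exact h.comp h1 fun x hx => ⟨by linarith [hx.1], by linarith [hx.2]⟩

end IsPiecewiseC1Path

/-! ### Length of paths and the Finsler metric -/

namespace PalaisFinsler

variable {X : Type*} [NormedAddCommGroup X] [NormedSpace ℝ X]
  {M : Type*} [TopologicalSpace M] [ChartedSpace X M] [IsManifold 𝓘(ℝ, X) 1 M]
  (F : PalaisFinsler X M) {c : ℝ → M} {a b : ℝ}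

/-- The speed of a path. -/
def speed (c : ℝ → M) (t : ℝ) : ℝ :=
  F.nrm (c t) (mfderiv 𝓘(ℝ, ℝ) 𝓘(ℝ, X) c t (1 : ℝ))

/-- The speed of a path defined on a subset of the line. -/
def speedWithin (c : ℝ → M) (s : Set ℝ) (t : ℝ) : ℝ :=
  F.nrm (c t) (mfderivWithin 𝓘(ℝ, ℝ) 𝓘(ℝ, X) c s t (1 : ℝ))

theorem length_eq (c : ℝ → M) (a b : ℝ) : F.length c a b = ∫ t in a..b, F.speed c t := rfl

theorem speed_nonneg (c : ℝ → M) (t : ℝ) : 0 ≤ F.speed c t := apply_nonneg _ _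

theorem length_nonneg (c : ℝ → M) (hab : a ≤ b) : 0 ≤ F.length c a b :=
  intervalIntegral.integral_nonneg hab fun t _ => F.speed_nonneg c t

theorem speed_eq_speedWithin (c : ℝ → M) :
    EqOn (F.speed c) (F.speedWithin c (Icc a b)) (Ioo a b) := by
  intro t ht
  simp only [speed, speedWithin, mfderivWithin_of_mem_nhds (Icc_mem_nhds ht.1 ht.2)]

/-- At the ends of a piece the two-sided derivative may fail to exist, hence the derivative within
the interval: it is continuous up to the ends and agrees with the usual one inside, which suffices
for integrals. -/
theorem continuousOn_speedWithin (hab : a < b)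
    (hc : ContMDiffOn 𝓘(ℝ, ℝ) 𝓘(ℝ, X) 1 c (Icc a b)) :
    ContinuousOn (F.speedWithin c (Icc a b)) (Icc a b) := by
  have h1 := hc.continuousOn_tangentMapWithin le_rfl
    (uniqueDiffOn_Icc hab).uniqueMDiffOn
  have h2 : Continuous fun t : ℝ => (⟨t, (1 : ℝ)⟩ : TangentBundle 𝓘(ℝ, ℝ) ℝ) :=
    (tangentBundleModelSpaceHomeomorph 𝓘(ℝ, ℝ)).symm.continuous.comp
      (continuous_id.prodMk continuous_const)
  exact F.continuous_nrm.comp_continuousOn (h1.comp h2.continuousOn fun t ht => ht)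

theorem intervalIntegrable_speed (hc : IsPiecewiseC1Path X c a b) :
    IntervalIntegrable (F.speed c) MeasureTheory.volume a b := by
  refine hc.induction (fun x => by simp) (fun s t hst _ _ h => ?_)
    (fun s t u _ _ h1 h2 => h1.trans h2)
  rcases hst.eq_or_lt with rfl | hlt
  · simp
  · refine ((F.continuousOn_speedWithin hlt h).intervalIntegrable_of_Icc hst).congr_uIoo ?_
    rw [uIoo_of_le hst]
    exact (F.speed_eq_speedWithin c).symm

theorem length_add (hc : IsPiecewiseC1Path X c a b) {d : ℝ} (hd : IsPiecewiseC1Path X c b d) :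
    F.length c a b + F.length c b d = F.length c a d :=
  intervalIntegral.integral_add_adjacent_intervals (F.intervalIntegrable_speed hc)
    (F.intervalIntegrable_speed hd)

theorem length_congr (hab : a ≤ b) {c c' : ℝ → M} (h : EqOn c' c (Ioo a b)) :
    F.length c' a b = F.length c a b := by
  refine intervalIntegral.integral_congr_Ioo_of_le hab fun t ht => ?_
  have h1 : c' =ᶠ[𝓝 t] c := h.eventuallyEq_of_mem (Ioo_mem_nhds ht.1 ht.2)
  have h2 : F.nrmAt (c' t) ((mfderiv 𝓘(ℝ, ℝ) 𝓘(ℝ, X) c' t : ℝ →L[ℝ] X) 1) =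
      F.nrmAt (c t) ((mfderiv 𝓘(ℝ, ℝ) 𝓘(ℝ, X) c t : ℝ →L[ℝ] X) 1) := by
    rw [h ht, h1.mfderiv_eq]
  exact h2

theorem speed_comp_add_right (c : ℝ → M) (k t : ℝ) :
    F.speed (fun t => c (t + k)) t = F.speed c (t + k) := by
  have hadd : ∀ l s : ℝ, HasMFDerivAt 𝓘(ℝ, ℝ) 𝓘(ℝ, ℝ) (fun t : ℝ => t + l) s
      (ContinuousLinearMap.id ℝ ℝ) := fun l s =>
    ((hasFDerivAt_id s).add_const l).hasMFDerivAt
  have h : (mfderiv 𝓘(ℝ, ℝ) 𝓘(ℝ, X) (fun t => c (t + k)) t : ℝ →L[ℝ] X) =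
      mfderiv 𝓘(ℝ, ℝ) 𝓘(ℝ, X) c (t + k) := by
    -- The length is defined for arbitrary maps; where `c` is not differentiable, both derivatives
    -- take the default value `0`.
    by_cases hd : MDifferentiableAt 𝓘(ℝ, ℝ) 𝓘(ℝ, X) c (t + k)
    · exact (HasMFDerivAt.comp t hd.hasMFDerivAt (hadd k t)).mfderiv
    · have hd' : ¬ MDifferentiableAt 𝓘(ℝ, ℝ) 𝓘(ℝ, X) (fun t => c (t + k)) t := by
        intro h
        refine hd ?_
        have h1 : MDifferentiableAt 𝓘(ℝ, ℝ) 𝓘(ℝ, X) (fun t => c (t + k)) ((t + k) + -k) := by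
          rwa [add_neg_cancel_right]
        have h2 := h1.comp (t + k) (hadd (-k) (t + k)).mdifferentiableAt
        convert h2 using 1
        ext s
        simp
      rw [mfderiv_zero_of_not_mdifferentiableAt hd, mfderiv_zero_of_not_mdifferentiableAt hd']
      rfl
  change F.nrmAt (c (t + k)) ((mfderiv 𝓘(ℝ, ℝ) 𝓘(ℝ, X) (fun t => c (t + k)) t : ℝ →L[ℝ] X) 1) = _
  rw [h]
  rfl

theorem length_comp_add_right (c : ℝ → M) (k a b : ℝ) :
    F.length (fun t => c (t + k)) (a - k) (b - k) = F.length c a b := by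
  simp only [length_eq, speed_comp_add_right]
  rw [intervalIntegral.integral_comp_add_right]
  simp

/-- Concatenation of piecewise `C^1` paths. -/
theorem exists_concat {c c' : ℝ → M} {a b a' b' : ℝ} (hc : IsPiecewiseC1Path X c a b)
    (hc' : IsPiecewiseC1Path X c' a' b') (h : c b = c' a') :
    ∃ (γ : ℝ → M) (s t : ℝ), IsPiecewiseC1Path X γ s t ∧ γ s = c a ∧ γ t = c' b' ∧
      F.length γ s t = F.length c a b + F.length c' a' b' := by
  classical
  have hab := hc.1
  have hab' := hc'.1
  set k := a' - b
  set γ : ℝ → M := fun t => if t ≤ b then c t else c' (t + k) with hγ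
  have e1 : EqOn γ c (Icc a b) := fun t ht => by simp [hγ, ht.2]
  have e2 : EqOn γ (fun t => c' (t + k)) (Icc (a' - k) (b' - k)) := by
    intro t ht
    rcases (show b ≤ t by simpa [k] using ht.1).eq_or_lt with rfl | hlt
    · simp [hγ, k, h]
    · simp [hγ, hlt.not_ge]
  have p1 := hc.congr e1
  have p2 := (hc'.comp_add_right k).congr e2
  have l1 := F.length_congr hab (e1.mono Ioo_subset_Icc_self)
  have l2 := F.length_congr (by linarith) (e2.mono Ioo_subset_Icc_self)
  have hk : a' - k = b := by simp [k]
  rw [F.length_comp_add_right, hk] at l2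
  rw [hk] at p2
  refine ⟨γ, a, b' - k, p1.trans p2, e1 ⟨le_rfl, hab⟩, ?_, ?_⟩
  · have := e2 ⟨by linarith, le_rfl⟩
    simpa using this
  · rw [← F.length_add p1 p2, l1, l2]

theorem dist_le_length (hc : IsPiecewiseC1Path X c a b) : F.dist (c a) (c b) ≤ F.length c a b := by
  refine csInf_le ⟨0, ?_⟩ ⟨c, a, b, hc, rfl, rfl, rfl⟩
  rintro _ ⟨c, a, b, h, -, -, rfl⟩
  exact F.length_nonneg c h.1

/-- Near each point, points can be joined by paths which are short in a chart. -/
theorem exists_path_length_le (x₀ : M) :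
    ∃ C : ℝ, ∀ᶠ y in 𝓝 x₀, ∀ᶠ z in 𝓝 x₀, ∃ (c : ℝ → M) (a b : ℝ), IsPiecewiseC1Path X c a b ∧
      c a = y ∧ c b = z ∧ F.length c a b ≤ C * ‖chartAt X x₀ z - chartAt X x₀ y‖ := by
  have hφ := IsManifold.chart_mem_maximalAtlas (I := 𝓘(ℝ, X)) (n := 1) x₀
  set φ := chartAt X x₀
  have hxs : x₀ ∈ φ.source := mem_chart_source X x₀
  obtain ⟨C, hC, hCv⟩ := F.exists_nrmAt_equiv hφ (φ.map_source hxs)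
  obtain ⟨r, hr, hrP⟩ := Metric.eventually_nhds_iff_ball.1
    ((F.eventually_nrmAt_le hφ (φ.map_source hxs) one_pos).and
      (φ.open_target.mem_nhds (φ.map_source hxs)))
  have hev : ∀ᶠ y in 𝓝 x₀, y ∈ φ.source ∧ φ y ∈ Metric.ball (φ x₀) r :=
    Filter.Eventually.and (φ.open_source.mem_nhds hxs)
      ((φ.continuousAt hxs).eventually (Metric.ball_mem_nhds _ hr))
  refine ⟨2 * C, hev.mono fun y hy => hev.mono fun z hz => ?_⟩
  set w := φ z - φ y with hw
  let l : ℝ → X := fun t => φ y + t • w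
  have hl : ContDiff ℝ 1 l := contDiff_const.add (contDiff_id.smul contDiff_const)
  have hlb : ∀ t ∈ Icc (0 : ℝ) 1, l t ∈ Metric.ball (φ x₀) r := fun t ht =>
    (convex_ball (φ x₀) r).add_smul_sub_mem hy.2 hz.2 ht
  let l' : ℝ →L[ℝ] X := (ContinuousLinearMap.id ℝ ℝ).smulRight w
  have hd : ∀ t, HasFDerivAt l l' t := fun t =>
    ((hasFDerivAt_id t).smul_const w).const_add (φ y)
  refine ⟨fun t => φ.symm (l t), 0, 1, IsPiecewiseC1Path.of_contMDiffOn zero_le_one ?_, ?_, ?_, ?_⟩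
  · exact (contMDiffOn_symm_of_mem_maximalAtlas hφ).comp hl.contMDiff.contMDiffOn
      fun t ht => (hrP _ (hlb t ht)).2
  · simp [l, φ.left_inv hy.1]
  · simp [l, hw, φ.left_inv hz.1]
  -- The factor `2` is `1 + ε` from (P2) with `ε = 1`, and `C` comes from (P1) at `x₀`.
  · have hsp : ∀ t ∈ Icc (0 : ℝ) 1, F.speed (fun t => φ.symm (l t)) t ≤ 2 * C * ‖w‖ := by
      intro t ht
      have h1 : HasMFDerivAt 𝓘(ℝ, X) 𝓘(ℝ, X) φ.symm (l t) (symmDeriv (X := X) φ (l t)) :=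
        ((mdifferentiable_of_mem_maximalAtlas hφ).mdifferentiableAt_symm
          (hrP _ (hlb t ht)).2).hasMFDerivAt
      have h2 := (HasMFDerivAt.comp t h1 (hd t).hasMFDerivAt).mfderiv
      have h3 : F.speed (fun t => φ.symm (l t)) t =
          F.nrmAt (φ.symm (l t)) (symmDeriv φ (l t) w) := by
        change F.nrmAt (φ.symm (l t))
          ((mfderiv 𝓘(ℝ, ℝ) 𝓘(ℝ, X) (φ.symm ∘ l) t : ℝ →L[ℝ] X) 1) = _
        rw [h2]
        change F.nrmAt (φ.symm (l t)) (symmDeriv φ (l t) ((1 : ℝ) • w)) = _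
        rw [one_smul]
      rw [h3]
      refine ((hrP _ (hlb t ht)).1 w).trans ?_
      have := (hCv w).2
      linarith
    have h := intervalIntegral.norm_integral_le_of_norm_le_const (a := (0 : ℝ)) (b := 1)
      (f := F.speed fun t => φ.symm (l t)) (C := 2 * C * ‖w‖) fun t ht => by
        rw [uIoc_of_le zero_le_one] at ht
        rw [Real.norm_of_nonneg (F.speed_nonneg _ _)]
        exact hsp t ⟨ht.1.le, ht.2⟩
    rw [sub_zero, abs_one, mul_one] at h
    exact (le_abs_self _).trans h

theorem exists_path (F : PalaisFinsler X M) [PreconnectedSpace M] (p q : M) :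
    ∃ (c : ℝ → M) (a b : ℝ), IsPiecewiseC1Path X c a b ∧ c a = p ∧ c b = q := by
  let R : Set M :=
    {q | ∃ (c : ℝ → M) (a b : ℝ), IsPiecewiseC1Path X c a b ∧ c a = p ∧ c b = q}
  have hstep : ∀ y z : M, y ∈ R → (∃ (c : ℝ → M) (a b : ℝ), IsPiecewiseC1Path X c a b ∧
      c a = y ∧ c b = z) → z ∈ R := by
    rintro _ _ ⟨c, a, b, hc, h1, rfl⟩ ⟨c', a', b', hc', h3, rfl⟩
    obtain ⟨γ, s, t, hγ, h5, h6, -⟩ := F.exists_concat hc hc' h3.symm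
    exact ⟨γ, s, t, hγ, h5.trans h1, h6⟩
  -- The set of points reachable from `p` is open and closed, by appending a short path in a chart.
  have hopen : IsOpen R := by
    refine isOpen_iff_mem_nhds.2 fun y hy => ?_
    obtain ⟨C, h⟩ := F.exists_path_length_le y
    filter_upwards [h.self_of_nhds] with z ⟨c, a, b, hc, h1, h2, _⟩
    exact hstep y z hy ⟨c, a, b, hc, h1, h2⟩
  have hclosed : IsClosed R := by
    refine isClosed_of_closure_subset fun z hz => ?_
    obtain ⟨C, h⟩ := F.exists_path_length_le z
    obtain ⟨y, ⟨c, a, b, hc, h1, h2, -⟩, hy⟩ :=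
      mem_closure_iff_nhds.1 hz _ (h.mono fun y hy => hy.self_of_nhds)
    exact hstep y z hy ⟨c, a, b, hc, h1, h2⟩
  have : R = univ := IsClopen.eq_univ ⟨hclosed, hopen⟩ ⟨p, fun _ => p, 0, 0, .refl _ _, rfl, rfl⟩
  exact (this ▸ mem_univ q : q ∈ R)

/-- The infimum of an empty set of reals is `0`, so the existence of at least one path has to be
supplied by connectedness. -/
theorem exists_path_length_lt [PreconnectedSpace M] {p q : M} {r : ℝ} (h : F.dist p q < r) :
    ∃ (c : ℝ → M) (a b : ℝ), IsPiecewiseC1Path X c a b ∧ c a = p ∧ c b = q ∧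
      F.length c a b < r := by
  obtain ⟨c, a, b, hc, h1, h2⟩ := F.exists_path p q
  obtain ⟨_, ⟨c, a, b, hc, h1, h2, rfl⟩, hlt⟩ :=
    exists_lt_of_csInf_lt (s := {l : ℝ | ∃ (c : ℝ → M) (a b : ℝ), IsPiecewiseC1Path X c a b ∧
      c a = p ∧ c b = q ∧ F.length c a b = l}) ⟨_, c, a, b, hc, h1, h2, rfl⟩ h
  exact ⟨c, a, b, hc, h1, h2, hlt⟩

theorem dist_le_dist_add_length [PreconnectedSpace M] (p : M) (hc : IsPiecewiseC1Path X c a b) :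
    F.dist p (c b) ≤ F.dist p (c a) + F.length c a b := by
  refine le_of_forall_pos_le_add fun ε hε => ?_
  obtain ⟨c', a', b', hc', rfl, h2, hlt⟩ :=
    F.exists_path_length_lt (show F.dist p (c a) < F.dist p (c a) + ε by linarith)
  obtain ⟨γ, s, t, hγ, h5, h6, h7⟩ := F.exists_concat hc' hc h2
  have := F.dist_le_length hγ
  rw [h5, h6, h7] at this
  linarith

theorem isOpen_ball [PreconnectedSpace M] (p : M) (r : ℝ) : IsOpen (F.ball p r) := by
  refine isOpen_iff_mem_nhds.2 fun x hx => ?_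
  have hx' : F.dist p x < r := hx
  obtain ⟨C, h⟩ := F.exists_path_length_le x
  have hcont : ContinuousAt (fun z => C * ‖chartAt X x z - chartAt X x x‖) x :=
    continuousAt_const.mul (((chartAt X x).continuousAt (mem_chart_source X x)).sub
      continuousAt_const).norm
  filter_upwards [h.self_of_nhds,
    hcont.eventually (gt_mem_nhds (show C * ‖chartAt X x x - chartAt X x x‖ < r - F.dist p x by
      simpa using hx'))] with z ⟨c, a, b, hc, h1, h2, h3⟩ hz
  have := F.dist_le_dist_add_length p hc
  rw [h1, h2] at this
  change F.dist p z < r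
  linarith

theorem mem_ball_self {p : M} {r : ℝ} (hr : 0 < r) : p ∈ F.ball p r := by
  have := F.dist_le_length (IsPiecewiseC1Path.refl (X := X) (fun _ => p) 0)
  rw [length_eq, intervalIntegral.integral_same] at this
  exact this.trans_lt hr

end PalaisFinsler

/-! ### From infinitesimal slopes to the Lipschitz estimate -/

namespace PalaisFinsler

variable {X : Type*} [NormedAddCommGroup X] [NormedSpace ℝ X]
  {M : Type*} [TopologicalSpace M] [ChartedSpace X M] [IsManifold 𝓘(ℝ, X) 1 M]
  (F : PalaisFinsler X M)

/-- The norm of the tangent space at `x`, read in the preferred chart at `x`. -/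
def chartSeminorm (x : M) : Seminorm ℝ X :=
  (F.nrmAt x).comp (symmDeriv (chartAt X x) (chartAt X x x)).toLinearMap

theorem chartSeminorm_apply (x : M) (v : X) :
    F.chartSeminorm x v = F.nrmAt x (symmDeriv (chartAt X x) (chartAt X x x) v) := rfl

theorem continuous_chartSeminorm (x : M) : Continuous (F.chartSeminorm x) := by
  have hφ := IsManifold.chart_mem_maximalAtlas (I := 𝓘(ℝ, X)) (n := 1) x
  have hxs := mem_chart_source X x
  obtain ⟨C, hC, h⟩ := F.exists_nrmAt_equiv hφ ((chartAt X x).map_source hxs)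
  rw [(chartAt X x).left_inv hxs] at h
  refine (LipschitzWith.of_dist_le_mul (K := C.toNNReal) fun v w => ?_).continuous
  rw [Real.coe_toNNReal _ (by linarith), Real.dist_eq, _root_.dist_eq_norm]
  exact (abs_sub_map_le_sub _ _ _).trans (h (v - w)).2

/-- `f` has slope at most `K` at each point of `S`, with respect to the Finsler norm. -/
def HasSlopeLEOn (K : ℝ) (f : M → ℝ) (S : Set M) : Prop :=
  ∀ x ∈ S, ∀ ε > 0, ∀ᶠ y in 𝓝 x,
    |f y - f x| ≤ K * ((1 + ε) * F.chartSeminorm x (chartAt X x y - chartAt X x x))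

theorem hasSlopeLEOn_of_dualNorm_le [CompleteSpace X] (hX : HasC1LipschitzBump X) [RegularSpace M]
    {S : Set M} (hS : IsOpen S) {f : M → ℝ} (hf : LowerSemicontinuousOn f S)
    {K : ℝ} (hK0 : 0 ≤ K) (hK : ∀ x ∈ S, ∀ ξ ∈ subdifferential X f S x, F.dualNorm x ξ ≤ K) :
    F.HasSlopeLEOn K f S := by
  intro x hx ε hε
  have hφ := IsManifold.chart_mem_maximalAtlas (I := 𝓘(ℝ, X)) (n := 1) x
  have hxs := mem_chart_source X x
  have h := F.eventually_abs_sub_le hX hS hf hK0 hK hφ ((chartAt X x).map_source hxs)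
    (by rwa [(chartAt X x).left_inv hxs]) hε
  rw [(chartAt X x).left_inv hxs] at h
  filter_upwards [((chartAt X x).continuousAt hxs).eventually h,
    (chartAt X x).open_source.mem_nhds hxs] with y hy hys
  rwa [(chartAt X x).left_inv hys] at hy

variable {F} {K : ℝ} {f : M → ℝ} {S : Set M}

theorem HasSlopeLEOn.continuousAt (h : F.HasSlopeLEOn K f S) {x : M} (hx : x ∈ S) :
    ContinuousAt f x := by
  rw [ContinuousAt, tendsto_iff_dist_tendsto_zero]
  have h1 : ContinuousAt
      (fun y => K * ((1 + 1) * F.chartSeminorm x (chartAt X x y - chartAt X x x))) x := by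
    refine continuousAt_const.mul (continuousAt_const.mul ?_)
    exact (F.continuous_chartSeminorm x).continuousAt.comp
      (((chartAt X x).continuousAt (mem_chart_source X x)).sub continuousAt_const)
  have h2 := h1.tendsto
  rw [sub_self, map_zero, mul_zero, mul_zero] at h2
  exact squeeze_zero' (Filter.Eventually.of_forall fun _ => dist_nonneg) (h x hx 1 one_pos) h2

/-- Read in the chart at `c x`, the right difference quotients of the path converge to its velocity,
whose seminorm is the speed. The strict inequality on `r` leaves room for both the factor `1 + ε`
and this limit. -/
theorem HasSlopeLEOn.eventually_abs_sub_lt (h : F.HasSlopeLEOn K f S) {c : ℝ → M}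
    {a b : ℝ} (hc : ContMDiffOn 𝓘(ℝ, ℝ) 𝓘(ℝ, X) 1 c (Icc a b)) {x : ℝ} (hx : x ∈ Ico a b)
    (hcx : c x ∈ S) {r : ℝ} (hr : K * F.speedWithin c (Icc a b) x < r) :
    ∀ᶠ z in 𝓝[>] x, |f (c z) - f (c x)| < r * (z - x) := by
  have hxI : x ∈ Icc a b := Ico_subset_Icc_self hx
  have hφ := IsManifold.chart_mem_maximalAtlas (I := 𝓘(ℝ, X)) (n := 1) (c x)
  have hxs := mem_chart_source X (c x)
  set φ := chartAt X (c x)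
  have hc1 := ((hc x hxI).mdifferentiableWithinAt one_ne_zero).hasMFDerivWithinAt
  have hφ1 := ((mdifferentiable_of_mem_maximalAtlas hφ).mdifferentiableAt hxs).hasMFDerivAt
  set D : ℝ →L[ℝ] X := mfderivWithin 𝓘(ℝ, ℝ) 𝓘(ℝ, X) c (Icc a b) x with hD
  set E : X →L[ℝ] X := mfderiv 𝓘(ℝ, X) 𝓘(ℝ, X) φ (c x) with hE
  have hcomp : HasFDerivWithinAt (φ ∘ c) (E.comp D) (Icc a b) x :=
    (hφ1.comp_hasMFDerivWithinAt x hc1).hasFDerivWithinAt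
  have hderiv : HasDerivWithinAt (φ ∘ c) (E (D 1)) (Icc a b) x := hcomp.hasDerivWithinAt
  have hN : F.chartSeminorm (c x) (E (D 1)) = F.speedWithin c (Icc a b) x := by
    have h1 : symmDeriv φ (φ (c x)) (E (D 1)) = D 1 := by
      have h1 := symmDeriv_mfderiv hφ (φ.map_source hxs) (D 1)
      rwa [φ.left_inv hxs] at h1
    rw [chartSeminorm_apply]
    change F.nrmAt (c x) (symmDeriv φ (φ (c x)) (E (D 1))) = F.nrmAt (c x) (D 1)
    rw [h1]
  have hle : 𝓝[>] x ≤ 𝓝[Icc a b \ {x}] x := by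
    rw [← nhdsWithin_Ioc_eq_nhdsGT hx.2]
    exact nhdsWithin_mono _ fun z hz =>
      ⟨⟨hx.1.trans hz.1.le, hz.2⟩, fun hzx => hz.1.ne' hzx⟩
  have hslope := (hasDerivWithinAt_iff_tendsto_slope.1 hderiv).mono_left hle
  obtain ⟨ε, hε, hεr⟩ : ∃ ε > 0, K * ((1 + ε) * F.speedWithin c (Icc a b) x) < r := by
    have hcont : ContinuousAt (fun ε : ℝ => K * ((1 + ε) * F.speedWithin c (Icc a b) x)) 0 := by
      fun_prop
    have h1 := hcont.eventually (gt_mem_nhds (show _ < r by simpa using hr))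
    obtain ⟨ε, h2, h3⟩ := ((h1.filter_mono nhdsWithin_le_nhds).and
      (self_mem_nhdsWithin : Ioi (0 : ℝ) ∈ 𝓝[>] 0)).exists
    exact ⟨ε, h3, h2⟩
  have hlim : Filter.Tendsto
      (fun z => K * ((1 + ε) * F.chartSeminorm (c x) (slope (φ ∘ c) x z))) (𝓝[>] x)
      (𝓝 (K * ((1 + ε) * F.speedWithin c (Icc a b) x))) := by
    rw [← hN]
    exact ((((F.continuous_chartSeminorm (c x)).tendsto _).comp hslope).const_mul _).const_mul _
  have hcc : Filter.Tendsto c (𝓝[>] x) (𝓝 (c x)) :=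
    (hc.continuousOn x hxI).mono_left (hle.trans (nhdsWithin_mono _ sdiff_subset))
  filter_upwards [hlim.eventually (gt_mem_nhds hεr), hcc.eventually (h _ hcx ε hε),
    self_mem_nhdsWithin] with z h1 h2 h3
  have h3 : 0 < z - x := sub_pos.2 h3
  refine h2.trans_lt ?_
  have h4 : φ (c z) - φ (c x) = (z - x) • slope (φ ∘ c) x z := by
    rw [sub_smul_slope]; rfl
  rw [h4, map_smul_eq_mul, Real.norm_of_nonneg h3.le]
  calc _ = K * ((1 + ε) * F.chartSeminorm (c x) (slope (φ ∘ c) x z)) * (z - x) := by ring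
    _ < _ := mul_lt_mul_of_pos_right h1 h3

theorem HasSlopeLEOn.abs_sub_le_of_contMDiffOn (h : F.HasSlopeLEOn K f S) {c : ℝ → M}
    {a b : ℝ} (hab : a ≤ b) (hc : ContMDiffOn 𝓘(ℝ, ℝ) 𝓘(ℝ, X) 1 c (Icc a b))
    (hS : MapsTo c (Icc a b) S) : |f (c b) - f (c a)| ≤ K * F.length c a b := by
  rcases hab.eq_or_lt with rfl | hlt
  · simp [length_eq]
  have hm := F.continuousOn_speedWithin hlt hc
  set m := F.speedWithin c (Icc a b)
  have hmi : IntervalIntegrable m MeasureTheory.volume a b := hm.intervalIntegrable_of_Icc hab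
  have hlen : F.length c a b = ∫ t in a..b, m t :=
    intervalIntegral.integral_congr_Ioo_of_le hab (F.speed_eq_speedWithin c)
  rw [hlen]
  refine le_of_forall_pos_le_add fun ε hε => ?_
  set η := ε / (b - a)
  have hba : 0 < b - a := sub_pos.2 hlt
  have hη : 0 < η := by positivity
  have hIderiv : ∀ x ∈ Icc a b, HasDerivWithinAt (fun x => ∫ t in a..x, m t) (m x) (Icc a b) x := by
    intro x hx
    have : Fact (x ∈ Icc a b) := ⟨hx⟩
    exact intervalIntegral.integral_hasDerivWithinAt_right
      (hmi.mono_set (by rw [uIcc_of_le hx.1, uIcc_of_le hab]; exact Icc_subset_Icc_right hx.2))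
      (hm.stronglyMeasurableAtFilter_nhdsWithin measurableSet_Icc x) (hm x hx)
  have hBderiv : ∀ x ∈ Icc a b, HasDerivWithinAt
      (fun x => K * (∫ t in a..x, m t) + η * (x - a)) (K * m x + η) (Icc a b) x := by
    intro x hx
    have := ((hIderiv x hx).const_mul K).add
      ((((hasDerivAt_id x).sub_const a).const_mul η).hasDerivWithinAt)
    exact this.congr_deriv (by simp)
  -- The comparison function is `K` times the length so far; the term `η * (x - a)` makes its
  -- derivative strictly larger than `K * m` and totals `ε` at `b`.
  have key := image_norm_le_of_liminf_right_slope_norm_lt_deriv_boundary (a := a) (b := b)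
    (f := fun t => f (c t) - f (c a)) (f' := fun t => K * m t)
    (B := fun x => K * (∫ t in a..x, m t) + η * (x - a)) (B' := fun x => K * m x + η)
    (fun x hx => (((h.continuousAt (hS hx)).comp_continuousWithinAt
      (hc.continuousOn x hx)).sub continuousWithinAt_const)) ?_ (by simp)
    (fun x hx => (hBderiv x hx).continuousWithinAt) ?_ (fun x _ _ => by linarith)
    (right_mem_Icc.2 hab)
  · have : η * (b - a) = ε := div_mul_cancel₀ _ hba.ne'
    simpa [this] using key
  · intro x hx r hr
    refine Filter.Eventually.frequently ?_
    filter_upwards [h.eventually_abs_sub_lt hc hx (hS (Ico_subset_Icc_self hx)) hr,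
      self_mem_nhdsWithin] with z hz hxz
    have hxz : 0 < z - x := sub_pos.2 hxz
    rw [slope_def_field, div_lt_iff₀ hxz]
    refine lt_of_le_of_lt ?_ hz
    refine (norm_sub_norm_le _ _).trans ?_
    rw [sub_sub_sub_cancel_right, Real.norm_eq_abs]
  · intro x hx
    refine (hBderiv x (Ico_subset_Icc_self hx)).mono_of_mem_nhdsWithin ?_
    exact Filter.mem_of_superset (Icc_mem_nhdsGE hx.2) (Icc_subset_Icc_left hx.1)

theorem HasSlopeLEOn.abs_sub_le_of_path (h : F.HasSlopeLEOn K f S) {c : ℝ → M}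
    {a b : ℝ} (hc : IsPiecewiseC1Path X c a b) (hS : MapsTo c (Icc a b) S) :
    |f (c b) - f (c a)| ≤ K * F.length c a b := by
  have := hc.induction (Q := fun s t => a ≤ s → t ≤ b → IntervalIntegrable (F.speed c)
      MeasureTheory.volume s t ∧ |f (c t) - f (c s)| ≤ K * F.length c s t)
    (fun x _ _ => by simp [length_eq]) (fun s t hst _ _ hC hs ht =>
      ⟨F.intervalIntegrable_speed (.of_contMDiffOn hst hC),
        h.abs_sub_le_of_contMDiffOn hst hC (hS.mono_left (Icc_subset_Icc hs ht))⟩)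
    (fun s t u hst htu h1 h2 hs hu => by
      obtain ⟨i1, e1⟩ := h1 hs (htu.trans hu)
      obtain ⟨i2, e2⟩ := h2 (hs.trans hst) hu
      refine ⟨i1.trans i2, ?_⟩
      have h3 : F.length c s t + F.length c t u = F.length c s u :=
        intervalIntegral.integral_add_adjacent_intervals i1 i2
      rw [← h3, mul_add]
      have := abs_sub_le (f (c u)) (f (c t)) (f (c s))
      linarith)
  exact (this le_rfl le_rfl).2

/-- Short paths starting in a ball stay in a larger ball. -/
theorem mapsTo_ball [PreconnectedSpace M] {p : M} {c : ℝ → M} {a b r s : ℝ}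
    (hc : IsPiecewiseC1Path X c a b) (h : F.dist p (c a) + F.length c a b < r) (hrs : r ≤ s) :
    MapsTo c (Icc a b) (F.ball p s) := by
  intro t ht
  have h1 := hc.restrict_left ht
  have h2 := hc.restrict_right ht
  have h3 := F.length_add h1 h2
  have h4 := F.length_nonneg c ht.2
  have h5 := F.dist_le_dist_add_length p h1
  change F.dist p (c t) < s
  linarith

theorem HasSlopeLEOn.abs_sub_le_dist [PreconnectedSpace M] {p y z : M} {s : ℝ}
    (h : F.HasSlopeLEOn K f (F.ball p s)) (hK : 0 ≤ K) (hyz : F.dist p y + F.dist y z < s) :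
    |f z - f y| ≤ K * F.dist y z := by
  refine le_of_forall_pos_le_add fun ε hε => ?_
  -- The excess length `η` must cost at most `ε` after multiplication by `K`, which may be `0`, and
  -- must keep the path inside the ball.
  set η := min (ε / (K + 1)) (s - (F.dist p y + F.dist y z)) with hη
  have hη0 : 0 < η := by
    have : 0 < s - (F.dist p y + F.dist y z) := by linarith
    positivity
  obtain ⟨c, a, b, hc, rfl, rfl, hlt⟩ :=
    F.exists_path_length_lt (show F.dist y z < F.dist y z + η by linarith)
  have h1 : η ≤ s - (F.dist p (c a) + F.dist (c a) (c b)) := min_le_right _ _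
  have h2 := h.abs_sub_le_of_path hc (mapsTo_ball hc (r := s) (by linarith) le_rfl)
  have h3 : K * η ≤ ε := by
    have h4 : η ≤ ε / (K + 1) := min_le_left _ _
    rw [le_div_iff₀ (by linarith)] at h4
    nlinarith
  nlinarith

end PalaisFinsler

end

/-! ### The theorem -/

theorem mainTheorem5
    {X : Type*} [NormedAddCommGroup X] [NormedSpace ℝ X] [CompleteSpace X]
    (hX : HasC1LipschitzBump X)
    {M : Type*} [TopologicalSpace M] [T2Space M] [ParacompactSpace M] [ConnectedSpace M]
    [ChartedSpace X M] [IsManifold 𝓘(ℝ, X) 1 M]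
    (F : PalaisFinsler X M) (p : M) (δ : ℝ) (hδ : 0 < δ) (K : ℝ) (f : M → ℝ)
    (hf : LowerSemicontinuousOn f (F.ball p (4 * δ)))
    (hK : ∀ x ∈ F.ball p (4 * δ), ∀ ξ ∈ subdifferential X f (F.ball p (4 * δ)) x,
      F.dualNorm x ξ ≤ K) :
    F.IsLipschitzOn K f (F.ball p δ) := by
  have hS := F.isOpen_ball p (4 * δ)
  have hK0 := F.nonneg_of_dualNorm_le hX hS ⟨p, F.mem_ball_self (by linarith)⟩ hf hK
  have h := F.hasSlopeLEOn_of_dualNorm_le hX hS hf hK0 hK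
  have hpp : F.dist p p ≤ 0 := by
    have := F.dist_le_length (IsPiecewiseC1Path.refl (X := X) (fun _ => p) 0)
    rwa [F.length_eq, intervalIntegral.integral_same] at this
  refine ⟨hK0, fun y hy z hz => ?_⟩
  have hy : F.dist p y < δ := hy
  have hz : F.dist p z < δ := hz
  -- If `y` and `z` are closer than `2δ`, almost shortest paths stay within `3δ` of `p`. Otherwise
  -- going through `p` suffices, since `d(p,y) + d(p,z) < 2δ`; this spares any appeal to the
  -- symmetry of the metric.
  rcases lt_or_ge (F.dist y z) (2 * δ) with hlt | hge
  · rw [abs_sub_comm]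
    exact h.abs_sub_le_dist hK0 (by linarith)
  · have h1 := h.abs_sub_le_dist hK0 (y := p) (z := y) (by linarith)
    have h2 := h.abs_sub_le_dist hK0 (y := p) (z := z) (by linarith)
    have h3 := abs_sub_le (f y) (f p) (f z)
    rw [abs_sub_comm (f p)] at h3
    have h4 : K * (F.dist p y + F.dist p z) ≤ K * F.dist y z :=
      mul_le_mul_of_nonneg_left (by linarith) hK0
    linarith
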